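/- Let $1<c<2$ and let $u$ be a real number with $u>2+\frac{4(c-1)}{2-c}$. Write $\mathbb N^c=\{\lfloor k^c\rfloor:k\in\mathbb N\}$. For real $X>e^e$ put $w=\log\log\log\log X$, $W=\prod_{p\le w,\ p\text{ prime}}p$ (an empty product being $1$) and $N=\lfloor X/W\rfloor+1$. For an integer $b$ with $0\le b<W$ and $\gcd(b,W)=1$, and for $n\in\mathbb Z$, let $$ \tau_{W,b}^{(c)}(n)=\begin{cases}c\,m^{1-\frac1c},&\text{if } m=Wn-b\in\mathbb N^c\cap[1,X],\\ 0,&\text{otherwise.}\end{cases} $$ Then there is a constant $C$, depending only on $c$ and $u$, such that for all such $X$ and $b$ and every function $f:\mathbb Z\to\mathbb C$ with $|f(n)|\le\tau_{W,b}^{(c)}(n)$ for all $n\in\mathbb Z$, $$ \int_0^1|\hat f(\alpha)|^u\,d\alpha\le C\,N^{u-1},\qquad\text{where }\hat f(\alpha)=\sum_{n\in\mathbb Z}f(n)e^{2\pi i n\alpha}. $$ -/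

import Mathlib

namespace PiatetskiShapiro

/-- The set `ℕ^c = {⌊n^c⌋ : n ∈ ℕ}` of Piatetski-Shapiro integers. -/
def psSet (c : ℝ) : Set ℤ := {m | ∃ k : ℕ, m = ⌊(k : ℝ) ^ c⌋}

/-- The modulus `W`, the product of all primes `p ≤ w`, where `w = log log log log X`
(the empty product `1` if `w < 2`). -/
noncomputable def trickW (X : ℝ) : ℕ :=
  primorial ⌊Real.log (Real.log (Real.log (Real.log X)))⌋₊

/-- The length `N = ⌊X / W⌋ + 1`, with `W` as above. -/
noncomputable def trickN (X : ℝ) : ℕ := ⌊X / (trickW X : ℝ)⌋₊ + 1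

open Classical in
/-- The function that takes the value `c m^(1 - 1/c)` at `n` if `m = W n - b` lies in
`ℕ^c ∩ [1, X]`, and the value `0` otherwise. -/
noncomputable def tau (c : ℝ) (W b : ℕ) (X : ℝ) (n : ℤ) : ℝ :=
  if (W : ℤ) * n - b ∈ psSet c ∧ 1 ≤ (W : ℤ) * n - b ∧ (((W : ℤ) * n - b : ℤ) : ℝ) ≤ X then
    c * (((W : ℤ) * n - b : ℤ) : ℝ) ^ (1 - 1 / c)
  else 0

/-- The Fourier transform `∑ n, f n e(n θ)`, where `e(x) = exp (2 π i x)`. It is used here for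
finitely supported `f` only. -/
noncomputable def fourierSum (f : ℤ → ℂ) (θ : ℝ) : ℂ :=
  ∑' n : ℤ, f n * Complex.exp (2 * Real.pi * Complex.I * (n * θ))

end PiatetskiShapiro

namespace PiatetskiShapiro

/-! Write γ = 1/c. If m = ⌊k^c⌋, then m^γ lies within O(m^(γ-1)) of the integer k, so a Fejér kernel
of length H ≈ m^(1-γ) evaluated at m^γ is ≫ m^(1-γ) there, and it is nonnegative everywhere. A fixed
multiple of it is thus a majorant ν of `tau` (`mul_rpow_le_fejerMajorant`). The mean value of the
Fejér kernel is 1, so the transform of ν is a multiple of a Dirichlet kernel, of length at most N,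
plus sums of e(h m^γ + nα) with 0 < |h| < H. On dyadic blocks the latter are controlled by a
discrete van der Corput second derivative test (`norm_sum_ex_le_of_second_difference`). The total
error is D ≪ W² X^(3/2-γ), uniformly in α (`norm_trigSum_fejerMajorant_le`).

This feeds a Stein–Tomas argument (`integral_norm_trigSum_rpow_le`). Let F be the transform of f,
let M bound ∑ ν, and put B² = 2MD. Where |F| > B, duality bounds the mass of |F|^u by a convolution
with the transform of ν. The Dirichlet part is handled by Young's inequality, and the error D is
absorbed thanks to the choice of B. What remains is at most B^(u-2) ∫ |F|², which Parseval
evaluates.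

Here M ≪ N, and since u/2 > 1 the L^(u/2) integral of the Dirichlet kernel is ≪ N^(u/2-1), so the
main term is N^(u/2) N^(u/2-1) = N^(u-1). In the remainder ∑ |f|² ≪ X^(1-γ) N, so it suffices that D
≪ N X^(-2(1-γ)/(u-2)). From X < NW and W ≪ X^ε one gets D ≪ N X^(1/2-γ+3ε). A suitable ε > 0 exists
when 2(1-γ)/(u-2) < γ - 1/2, which is the hypothesis on u. -/

/-! ### The character e(x). -/

/-- The additive character `e(x) = exp (2 π i x)`. -/
noncomputable def ex (x : ℝ) : ℂ := Complex.exp (2 * Real.pi * Complex.I * x)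

lemma norm_ex (x : ℝ) : ‖ex x‖ = 1 := by
  rw [ex, show (2 * Real.pi * Complex.I * x : ℂ) = ((2 * Real.pi * x : ℝ) : ℂ) * Complex.I by
    push_cast; ring]
  exact Complex.norm_exp_ofReal_mul_I _

lemma ex_add (x y : ℝ) : ex (x + y) = ex x * ex y := by
  rw [ex, ex, ex, ← Complex.exp_add]; push_cast; ring_nf

lemma ex_zero : ex 0 = 1 := by simp [ex]

lemma ex_int (n : ℤ) : ex n = 1 := by
  rw [ex, Complex.exp_eq_one_iff]
  exact ⟨n, by push_cast; ring⟩

lemma ex_sub_int (x : ℝ) (n : ℤ) : ex (x - n) = ex x := by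
  have h := ex_add (x - n) n
  rw [ex_int, sub_add_cancel, mul_one] at h
  exact h.symm

lemma conj_ex (x : ℝ) : (starRingEnd ℂ) (ex x) = ex (-x) := by
  rw [ex, ex, ← Complex.exp_conj]
  simp [map_ofNat]

lemma continuous_ex : Continuous ex := by
  unfold ex; fun_prop

lemma ex_eq (x : ℝ) : ex x =
    ((Real.cos (Real.pi * x) : ℂ) + Real.sin (Real.pi * x) * Complex.I) ^ 2 := by
  rw [ex, Complex.ofReal_cos, Complex.ofReal_sin, ← Complex.exp_mul_I, ← Complex.exp_nat_mul]
  push_cast; ring_nf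

/-! ### The Kusmin–Landau inequality. -/

/-- The value of `1 / (1 - e(x))` for non-integral `x`. -/
noncomputable def invOneSubEx (x : ℝ) : ℂ :=
  1 / 2 + ((Real.cot (Real.pi * x) / 2 : ℝ) : ℂ) * Complex.I

lemma invOneSubEx_mul {x : ℝ} (h : Real.sin (Real.pi * x) ≠ 0) :
    invOneSubEx x * (1 - ex x) = 1 := by
  have h' : (Real.sin (Real.pi * x) : ℂ) ≠ 0 := by exact_mod_cast h
  have h1 : (Real.cos (Real.pi * x) : ℂ) ^ 2 = 1 - (Real.sin (Real.pi * x) : ℂ) ^ 2 := by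
    have := Real.cos_sq' (Real.pi * x)
    exact_mod_cast this
  rw [invOneSubEx, ex_eq, Real.cot_eq_cos_div_sin]
  push_cast at *
  generalize Complex.sin (Real.pi * x) = s at *
  generalize Complex.cos (Real.pi * x) = k at *
  have hI := Complex.I_sq
  field_simp
  linear_combination (s - k * Complex.I) * h1 +
    (-s ^ 3 - 2 * k ^ 2 * s - k * s ^ 2 * Complex.I) * hI

lemma two_mul_le_sin_pi_mul {x d : ℝ} (h0 : 0 < d) (h1 : d ≤ x) (h2 : x ≤ 1 - d) :
    2 * d ≤ Real.sin (Real.pi * x) := by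
  have hpi := Real.pi_pos
  rcases le_total x (1 / 2) with h | h
  · have := Real.mul_le_sin (x := Real.pi * x) (by nlinarith) (by nlinarith)
    have e : 2 / Real.pi * (Real.pi * x) = 2 * x := by field_simp
    linarith
  · have := Real.mul_le_sin (x := Real.pi * (1 - x)) (by nlinarith) (by nlinarith)
    have e : 2 / Real.pi * (Real.pi * (1 - x)) = 2 * (1 - x) := by field_simp
    have e2 : Real.sin (Real.pi * (1 - x)) = Real.sin (Real.pi * x) := by
      rw [mul_sub, mul_one, Real.sin_pi_sub]
    linarith

lemma norm_one_sub_ex (x : ℝ) : ‖(1 : ℂ) - ex x‖ = 2 * |Real.sin (Real.pi * x)| := by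
  have : (1 : ℂ) - ex x = ((-2 * Real.sin (Real.pi * x) : ℝ) : ℂ) * Complex.I *
      (Complex.exp ((Real.pi * x : ℝ) * Complex.I)) := by
    rw [ex_eq, Complex.exp_mul_I, ← Complex.ofReal_cos, ← Complex.ofReal_sin]
    have h1 : (Real.cos (Real.pi * x) : ℂ) ^ 2 = 1 - (Real.sin (Real.pi * x) : ℂ) ^ 2 := by
      have := Real.cos_sq' (Real.pi * x)
      exact_mod_cast this
    have hI := Complex.I_sq
    push_cast at *
    linear_combination (-1) * h1 + (Complex.sin (Real.pi * x))^2 * hI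
  rw [this, norm_mul, norm_mul, Complex.norm_exp_ofReal_mul_I, Complex.norm_I,
    Complex.norm_real, Real.norm_eq_abs, abs_mul]
  norm_num

lemma norm_invOneSubEx_le {x d : ℝ} (h0 : 0 < d) (h1 : d ≤ x) (h2 : x ≤ 1 - d) :
    ‖invOneSubEx x‖ ≤ 1 / (4 * d) := by
  have hs := two_mul_le_sin_pi_mul h0 h1 h2
  have hm := invOneSubEx_mul (x := x) (by linarith)
  have hn : ‖(1 : ℂ) - ex x‖ = 2 * Real.sin (Real.pi * x) := by
    rw [norm_one_sub_ex, abs_of_pos (by linarith)]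
  have := congrArg norm hm
  rw [norm_mul, hn, norm_one] at this
  rw [le_div_iff₀ (by positivity)]
  have := norm_nonneg (invOneSubEx x)
  nlinarith

lemma abs_cot_le {x d : ℝ} (h0 : 0 < d) (h1 : d ≤ x) (h2 : x ≤ 1 - d) :
    |Real.cot (Real.pi * x)| ≤ 1 / (2 * d) := by
  have hs := two_mul_le_sin_pi_mul h0 h1 h2
  rw [Real.cot_eq_cos_div_sin, abs_div, abs_of_pos (by linarith : 0 < Real.sin (Real.pi * x))]
  exact div_le_div₀ zero_le_one (Real.abs_cos_le_one _) (by positivity) hs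

lemma cot_antitone {x y : ℝ} (h0 : 0 < x) (hxy : x ≤ y) (h1 : y < 1) :
    Real.cot (Real.pi * y) ≤ Real.cot (Real.pi * x) := by
  have hpi := Real.pi_pos
  have hsx : 0 < Real.sin (Real.pi * x) :=
    Real.sin_pos_of_pos_of_lt_pi (by positivity) (by nlinarith)
  have hsy : 0 < Real.sin (Real.pi * y) :=
    Real.sin_pos_of_pos_of_lt_pi (by nlinarith) (by nlinarith)
  rw [Real.cot_eq_cos_div_sin, Real.cot_eq_cos_div_sin, div_le_div_iff₀ hsy hsx]
  have : 0 ≤ Real.sin (Real.pi * y - Real.pi * x) :=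
    Real.sin_nonneg_of_nonneg_of_le_pi (by nlinarith) (by nlinarith)
  rw [Real.sin_sub] at this
  linarith

/-- The real part of 1/(1 - e(x)) is constantly 1/2, so only the monotone cotangent varies. The
total variation along a monotone sequence therefore telescopes, which is what makes the partial
summation in `kusmin_landau` efficient. -/
lemma norm_invOneSubEx_sub {x y : ℝ} (h0 : 0 < x) (hxy : x ≤ y) (h1 : y < 1) :
    ‖invOneSubEx y - invOneSubEx x‖ =
      (Real.cot (Real.pi * x) - Real.cot (Real.pi * y)) / 2 := by
  have h := cot_antitone h0 hxy h1
  have : invOneSubEx y - invOneSubEx x =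
      (((Real.cot (Real.pi * y) - Real.cot (Real.pi * x)) / 2 : ℝ) : ℂ) * Complex.I := by
    rw [invOneSubEx, invOneSubEx]; push_cast; ring
  rw [this, norm_mul, Complex.norm_I, Complex.norm_real, Real.norm_eq_abs, mul_one,
    abs_of_nonpos (by linarith)]
  ring

/-- The Kusmin–Landau inequality, for a phase with monotone increments. -/
theorem kusmin_landau (f : ℕ → ℝ) (n : ℕ) (v : ℤ) (d : ℝ) (hd : 0 < d)
    (hl : ∀ i < n, d ≤ f (i + 1) - f i - v) (hr : ∀ i < n, f (i + 1) - f i - v ≤ 1 - d)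
    (hm : ∀ i, i + 1 < n → f (i + 1) - f i ≤ f (i + 2) - f (i + 1)) :
    ‖∑ i ∈ Finset.range n, ex (f i)‖ ≤ 1 / d := by
  set x : ℕ → ℝ := fun i => f (i + 1) - f i - v with hx
  have hsin : ∀ i < n, Real.sin (Real.pi * x i) ≠ 0 := fun i hi => by
    have := two_mul_le_sin_pi_mul hd (hl i hi) (hr i hi)
    linarith
  have hstep : ∀ i, ex (f (i + 1)) = ex (f i) * ex (x i) := fun i => by
    rw [hx, ex_sub_int, ← ex_add]; ring_nf
  have hkey : ∀ i < n, ex (f i) + ex (f (i + 1)) * invOneSubEx (x i) =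
      ex (f i) * invOneSubEx (x i) := fun i hi => by
    rw [hstep]
    linear_combination (-ex (f i)) * invOneSubEx_mul (hsin i hi)
  -- Abel summation based on e(f i) = (e(f i) - e(f (i+1))) / (1 - e(x i)). Keeping the boundary
  -- term on the left lets the variation telescope; removing it at the end costs another 1/(4d).
  have hind : ∀ b, b < n → ‖∑ i ∈ Finset.range (b + 1), ex (f i) +
      ex (f (b + 1)) * invOneSubEx (x b)‖ ≤
      1 / (4 * d) + (Real.cot (Real.pi * x 0) - Real.cot (Real.pi * x b)) / 2 := by
    intro b
    induction b with
    | zero =>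
      intro hb
      rw [zero_add, Finset.sum_range_one, hkey 0 hb, norm_mul, norm_ex, one_mul, sub_self,
        zero_div, add_zero]
      exact norm_invOneSubEx_le hd (hl 0 hb) (hr 0 hb)
    | succ b ih =>
      intro hb
      have ih := ih (by omega)
      have hmono : x b ≤ x (b + 1) := by
        have := hm b hb
        simp only [hx]; linarith
      have h1 : ∑ i ∈ Finset.range (b + 1 + 1), ex (f i) +
          ex (f (b + 1 + 1)) * invOneSubEx (x (b + 1)) =
          (∑ i ∈ Finset.range (b + 1), ex (f i) + ex (f (b + 1)) * invOneSubEx (x b)) +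
          ex (f (b + 1)) * (invOneSubEx (x (b + 1)) - invOneSubEx (x b)) := by
        rw [Finset.sum_range_succ _ (b + 1), add_assoc, hkey (b + 1) hb]; ring
      have h2 : ‖ex (f (b + 1)) * (invOneSubEx (x (b + 1)) - invOneSubEx (x b))‖ =
          (Real.cot (Real.pi * x b) - Real.cot (Real.pi * x (b + 1))) / 2 := by
        rw [norm_mul, norm_ex, one_mul]
        have h3 := hl b (by omega)
        have h4 := hr (b + 1) hb
        exact norm_invOneSubEx_sub (lt_of_lt_of_le hd h3) hmono
          (lt_of_le_of_lt h4 (by linarith))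
      rw [h1]
      refine (norm_add_le _ _).trans ?_
      rw [h2]
      linarith
  rcases n with _ | n
  · simp [hd.le]
  have h1 := hind n (Nat.lt_succ_self n)
  have h2 := norm_invOneSubEx_le hd (hl n (Nat.lt_succ_self n)) (hr n (Nat.lt_succ_self n))
  have h3 := abs_le.1 (abs_cot_le hd (hl n (Nat.lt_succ_self n)) (hr n (Nat.lt_succ_self n)))
  have h4 := abs_le.1 (abs_cot_le hd (hl 0 (Nat.succ_pos n)) (hr 0 (Nat.succ_pos n)))
  have h5 : ‖ex (f (n + 1)) * invOneSubEx (x n)‖ ≤ 1 / (4 * d) := by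
    rw [norm_mul, norm_ex, one_mul]; exact h2
  have h6 := norm_sub_le (∑ i ∈ Finset.range (n + 1), ex (f i) +
    ex (f (n + 1)) * invOneSubEx (x n)) (ex (f (n + 1)) * invOneSubEx (x n))
  rw [add_sub_cancel_right] at h6
  have e1 : 1 / (4 * d) = 1 / d / 4 := by field_simp
  have e2 : 1 / (2 * d) = 1 / d / 2 := by field_simp
  have h7 : x 0 = f (0 + 1) - f 0 - v := rfl
  have h8 : x n = f (n + 1) - f n - v := rfl
  rw [← h7] at h4
  rw [← h8] at h3
  rw [e1] at h1 h5
  rw [e2] at h3 h4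
  linarith

/-! ### Van der Corput's second derivative test. -/

/-- A convex set of indices is a block of consecutive integers; this turns the indices with
increments in a given interval into a sum to which `kusmin_landau` applies. -/
lemma sum_filter_eq_sum_range (L : ℕ) (p : ℕ → Prop) [DecidablePred p]
    (hp : ∀ i j k, i ≤ j → j ≤ k → k < L → p i → p k → p j) :
    ∃ a n, a + n ≤ L ∧ (∀ i < n, p (a + i)) ∧ ∀ F : ℕ → ℂ,
      ∑ i ∈ (Finset.range L).filter p, F i = ∑ i ∈ Finset.range n, F (a + i) := by
  rcases ((Finset.range L).filter p).eq_empty_or_nonempty with h | h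
  · exact ⟨0, 0, by omega, by simp, fun F => by rw [h]; simp⟩
  set s := (Finset.range L).filter p with hs
  have hmin := Finset.mem_filter.1 (Finset.min'_mem s h)
  have hmax := Finset.mem_filter.1 (Finset.max'_mem s h)
  have hle := Finset.min'_le s _ (Finset.max'_mem s h)
  set a := s.min' h with ha
  set c := s.max' h with hc
  rw [Finset.mem_range] at hmin hmax
  have hset : s = Finset.Ico a (c + 1) := by
    ext i
    rw [Finset.mem_Ico]
    constructor
    · intro hi
      have h1 := Finset.min'_le s _ hi
      have h2 := Finset.le_max' s _ hi
      omega
    · rintro ⟨h1, h2⟩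
      rw [hs, Finset.mem_filter, Finset.mem_range]
      exact ⟨by omega, hp a i c h1 (by omega) hmax.1 hmin.2 hmax.2⟩
  refine ⟨a, c + 1 - a, by omega, fun i hi => ?_, fun F => ?_⟩
  · exact hp a (a + i) c (by omega) (by omega) hmax.1 hmin.2 hmax.2
  · rw [hset, Finset.sum_Ico_eq_sum_range]

/-- Since `g` climbs by at least `l` per index, the first and last index in `s` differ by at most
d/l. -/
lemma card_le_of_spaced (g : ℕ → ℝ) (s : Finset ℕ) (p l d : ℝ) (hl : 0 < l) (hd : 0 ≤ d)
    (hg : ∀ i ∈ s, ∀ j ∈ s, i ≤ j → l * ((j : ℝ) - i) ≤ g j - g i)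
    (h : ∀ i ∈ s, p ≤ g i ∧ g i ≤ p + d) : (s.card : ℝ) ≤ d / l + 1 := by
  rcases s.eq_empty_or_nonempty with h0 | h0
  · rw [h0]; simp; positivity
  have hmin := Finset.min'_mem s h0
  have hmax := Finset.max'_mem s h0
  have hle := Finset.min'_le s _ hmax
  have hsub : s ⊆ Finset.Icc (s.min' h0) (s.max' h0) := fun i hi =>
    Finset.mem_Icc.2 ⟨Finset.min'_le s _ hi, Finset.le_max' s _ hi⟩
  have hc := Finset.card_le_card hsub
  rw [Nat.card_Icc] at hc
  have hc' : (s.card : ℝ) ≤ (s.max' h0 : ℝ) - s.min' h0 + 1 := by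
    have : s.card + s.min' h0 ≤ s.max' h0 + 1 := by omega
    have : (s.card : ℝ) + s.min' h0 ≤ s.max' h0 + 1 := by exact_mod_cast this
    linarith
  have h1 := hg _ hmin _ hmax hle
  have h2 : (s.max' h0 : ℝ) - s.min' h0 ≤ d / l := by
    rw [le_div_iff₀ hl]
    have := h _ hmin
    have := h _ hmax
    linarith
  linarith

/-- The van der Corput second derivative test, with second differences instead of second
derivatives. -/
theorem norm_sum_ex_le_of_second_difference (f : ℕ → ℝ) (L : ℕ) (l M : ℝ) (hl : 0 < l)
    (hl1 : l ≤ 1 / 4) (h1 : ∀ i < L, l ≤ f (i + 2) - 2 * f (i + 1) + f i)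
    (h2 : ∀ i < L, f (i + 2) - 2 * f (i + 1) + f i ≤ M) :
    ‖∑ i ∈ Finset.range L, ex (f i)‖ ≤ (M * L + 2) * (4 / √l) := by
  classical
  rcases Nat.eq_zero_or_pos L with hL | hL
  · subst hL; simp; positivity
  set g : ℕ → ℝ := fun i => f (i + 1) - f i with hg
  have hsucc : ∀ i < L, g i + l ≤ g (i + 1) ∧ g (i + 1) ≤ g i + M := fun i hi => by
    have := h1 i hi
    have := h2 i hi
    simp only [hg]
    constructor <;> linarith
  have hgl : ∀ i k, i + k ≤ L → l * k ≤ g (i + k) - g i ∧ g (i + k) - g i ≤ M * k := by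
    intro i k
    induction k with
    | zero => simp
    | succ k ih =>
      intro hk
      have := ih (by omega)
      have := hsucc (i + k) (by omega)
      rw [← add_assoc]
      push_cast
      constructor <;> linarith
  have hgl' : ∀ i j, i ≤ j → j ≤ L → l * ((j : ℝ) - i) ≤ g j - g i := by
    intro i j hij hj
    obtain ⟨k, rfl⟩ := Nat.exists_eq_add_of_le hij
    have := (hgl i k hj).1
    push_cast
    linarith
  have hmono : ∀ i j, i ≤ j → j ≤ L → g i ≤ g j := by
    intro i j hij hj
    have := hgl' i j hij hj
    have : (0 : ℝ) ≤ (j : ℝ) - i := by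
      rw [sub_nonneg]; exact_mod_cast hij
    nlinarith
  have hsq : 0 < √l := Real.sqrt_pos.2 hl
  have hsq2 : √l ≤ 1 / 2 := by
    rw [Real.sqrt_le_left (by norm_num)]; linarith
  have hll : √l * √l = l := Real.mul_self_sqrt hl.le
  -- This cutoff balances the two costs for each integer v: at most d/l + 1 = 1/d + 1 indices near
  -- either end of [v, v+1], estimated trivially, and 1/d from Kusmin–Landau in the middle. As d ≤
  -- 1/2, the total 3/d + 2 is at most 4/d.
  set d := √l with hd
  have hdl : d / l = 1 / d := by
    rw [← hll]; field_simp
  have hfib : ∀ v : ℤ, ‖∑ i ∈ (Finset.range L).filter (fun i => ⌊g i⌋ = v), ex (f i)‖ ≤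
      4 / d := by
    intro v
    set T := (Finset.range L).filter (fun i => ⌊g i⌋ = v) with hT
    have hTm : ∀ i ∈ T, i < L ∧ (v : ℝ) ≤ g i ∧ g i < v + 1 := fun i hi => by
      rw [hT, Finset.mem_filter, Finset.mem_range, Int.floor_eq_iff] at hi
      exact hi
    set B := (Finset.range L).filter (fun i => v + d ≤ g i ∧ g i ≤ v + 1 - d) with hB
    set A := T.filter (fun i => g i < v + d) with hA
    set C := T.filter (fun i => ¬ g i < v + d ∧ v + 1 - d < g i) with hC
    have hsplit : ∑ i ∈ T, ex (f i) =
        ∑ i ∈ A, ex (f i) + (∑ i ∈ C, ex (f i) + ∑ i ∈ B, ex (f i)) := by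
      rw [← Finset.sum_filter_add_sum_filter_not T (fun i => g i < v + d)]
      congr 1
      rw [← Finset.sum_filter_add_sum_filter_not
        (T.filter (fun i => ¬ g i < v + d)) (fun i => v + 1 - d < g i)]
      congr 1
      · refine Finset.sum_congr ?_ (fun _ _ => rfl)
        ext i
        simp only [hC, Finset.mem_filter, and_assoc]
      refine Finset.sum_congr ?_ (fun _ _ => rfl)
      ext i
      simp only [hT, hB, Finset.mem_filter, not_lt, Int.floor_eq_iff]
      constructor
      · rintro ⟨⟨⟨h1, _⟩, h2⟩, h3⟩
        exact ⟨h1, h2, h3⟩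
      · rintro ⟨h1, h2, h3⟩
        exact ⟨⟨⟨h1, by linarith, by linarith⟩, h2⟩, h3⟩
    have hcard : ∀ s : Finset ℕ, ‖∑ i ∈ s, ex (f i)‖ ≤ s.card := fun s => by
      refine (norm_sum_le _ _).trans ?_
      simp [norm_ex]
    have hAc : (A.card : ℝ) ≤ d / l + 1 := by
      refine card_le_of_spaced g A v l d hl hsq.le (fun i hi j hj hij => ?_) (fun i hi => ?_)
      · exact hgl' i j hij (hTm j (Finset.mem_filter.1 hj).1).1.le
      · have := Finset.mem_filter.1 hi
        exact ⟨(hTm i this.1).2.1, this.2.le⟩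
    have hCc : (C.card : ℝ) ≤ d / l + 1 := by
      refine card_le_of_spaced g C (v + 1 - d) l d hl hsq.le (fun i hi j hj hij => ?_)
        (fun i hi => ?_)
      · exact hgl' i j hij (hTm j (Finset.mem_filter.1 hj).1).1.le
      · have := Finset.mem_filter.1 hi
        exact ⟨this.2.2.le, by linarith [(hTm i this.1).2.2]⟩
    have hBs : ‖∑ i ∈ B, ex (f i)‖ ≤ 1 / d := by
      obtain ⟨a, n, han, hp, hF⟩ := sum_filter_eq_sum_range L
        (fun i => v + d ≤ g i ∧ g i ≤ v + 1 - d) (fun i j k hij hjk hk hi hk' =>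
          ⟨hi.1.trans (hmono i j hij (by omega)), (hmono j k hjk hk.le).trans hk'.2⟩)
      rw [hB, hF]
      refine kusmin_landau (fun i => f (a + i)) n v d hsq (fun i hi => ?_) (fun i hi => ?_)
        (fun i hi => ?_)
      · have := (hp i hi).1
        simp only [hg] at this
        rw [← add_assoc]
        linarith
      · have := (hp i hi).2
        simp only [hg] at this
        rw [← add_assoc]
        linarith
      · exact hmono (a + i) (a + i + 1) (by omega) (by omega)
    have hd2 : 2 ≤ 1 / d := by
      rw [le_div_iff₀ hsq]; linarith
    rw [hsplit]
    have n1 := norm_add_le (∑ i ∈ A, ex (f i)) (∑ i ∈ C, ex (f i) + ∑ i ∈ B, ex (f i))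
    have n2 := norm_add_le (∑ i ∈ C, ex (f i)) (∑ i ∈ B, ex (f i))
    have n3 := hcard A
    have n4 := hcard C
    rw [hdl] at hAc hCc
    have : 4 / d = 4 * (1 / d) := by ring
    linarith
  -- The increments rise by at most ML in total, so their integer parts take at most ML + 2 values,
  -- each costing 4/d.
  rw [← Finset.sum_fiberwise_of_maps_to (t := Finset.Icc ⌊g 0⌋ ⌊g L⌋) (g := fun i => ⌊g i⌋)
    (fun i hi => Finset.mem_Icc.2 ⟨Int.floor_le_floor (hmono 0 i (Nat.zero_le _)
      (Finset.mem_range.1 hi).le), Int.floor_le_floor (hmono i L (Finset.mem_range.1 hi).le le_rfl)⟩)]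
  refine (norm_sum_le _ _).trans ?_
  refine (Finset.sum_le_card_nsmul _ _ _ (fun v _ => hfib v)).trans ?_
  rw [nsmul_eq_mul]
  apply mul_le_mul_of_nonneg_right _ (by positivity)
  rw [Int.card_Icc]
  have h3 := (hgl 0 L (by omega)).2
  rw [zero_add] at h3
  have h4 : ⌊g 0⌋ ≤ ⌊g L⌋ := Int.floor_le_floor (hmono 0 L (Nat.zero_le _) le_rfl)
  have h5 : (((⌊g L⌋ + 1 - ⌊g 0⌋).toNat : ℤ) : ℝ) = ⌊g L⌋ + 1 - ⌊g 0⌋ := by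
    rw [Int.toNat_of_nonneg (by omega)]; push_cast; ring
  have h6 : (((⌊g L⌋ + 1 - ⌊g 0⌋).toNat : ℕ) : ℝ) = ⌊g L⌋ + 1 - ⌊g 0⌋ := by
    rw [← h5]; norm_cast
  rw [h6]
  have := Int.floor_le (g L)
  have := Int.lt_floor_add_one (g 0)
  linarith

/-! ### Orthogonality, Parseval and duality on the circle. -/

open MeasureTheory intervalIntegral

lemma integral_ex_int (j : ℤ) : ∫ x in (0 : ℝ)..1, ex (j * x) = if j = 0 then 1 else 0 := by
  split_ifs with h
  · subst h; simp [ex_zero]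
  · have hj : (2 * Real.pi * Complex.I * j : ℂ) ≠ 0 := by
      have : (j : ℂ) ≠ 0 := by exact_mod_cast h
      have := Real.pi_ne_zero
      simp [*]
    have h1 : ∀ x : ℝ, ex (j * x) = Complex.exp ((2 * Real.pi * Complex.I * j) * x) := fun x => by
      rw [ex]; push_cast; ring_nf
    simp_rw [h1]
    rw [integral_exp_mul_complex hj]
    have h2 := ex_int j
    rw [ex] at h2
    push_cast at h2
    simp [h2]

lemma integral_add_of_continuous {f g : ℝ → ℝ} (hf : Continuous f) (hg : Continuous g) :
    ∫ x in (0 : ℝ)..1, (f x + g x) = (∫ x in (0 : ℝ)..1, f x) + ∫ x in (0 : ℝ)..1, g x :=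
  intervalIntegral.integral_add (hf.intervalIntegrable _ _) (hg.intervalIntegrable _ _)

/-- The trigonometric polynomial with coefficients `f` and frequencies in `s`. -/
noncomputable def trigSum (s : Finset ℤ) (f : ℤ → ℂ) (x : ℝ) : ℂ := ∑ n ∈ s, f n * ex (n * x)

lemma continuous_trigSum (s : Finset ℤ) (f : ℤ → ℂ) : Continuous (trigSum s f) := by
  unfold trigSum
  refine continuous_finsetSum _ fun n _ => continuous_const.mul ?_
  exact continuous_ex.comp (continuous_const.mul continuous_id)

lemma integral_norm_trigSum_sq (s : Finset ℤ) (f : ℤ → ℂ) :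
    ∫ x in (0 : ℝ)..1, ‖trigSum s f x‖ ^ 2 = ∑ n ∈ s, ‖f n‖ ^ 2 := by
  have h : ((∫ x in (0 : ℝ)..1, ‖trigSum s f x‖ ^ 2 : ℝ) : ℂ) =
      ((∑ n ∈ s, ‖f n‖ ^ 2 : ℝ) : ℂ) := by
    rw [← intervalIntegral.integral_ofReal]
    have h1 : ∀ x : ℝ, ((‖trigSum s f x‖ ^ 2 : ℝ) : ℂ) =
        ∑ n ∈ s, ∑ m ∈ s, (f n * (starRingEnd ℂ) (f m)) * ex ((n - m : ℤ) * x) := fun x => by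
      rw [Complex.ofReal_pow, ← Complex.mul_conj', trigSum, map_sum, Finset.sum_mul_sum]
      refine Finset.sum_congr rfl fun n _ => Finset.sum_congr rfl fun m _ => ?_
      have : ((n - m : ℤ) : ℝ) * x = n * x + -(m * x) := by push_cast; ring
      rw [map_mul, conj_ex, this, ex_add]; ring
    have hc : ∀ (a : ℂ) (j : ℤ), IntervalIntegrable (fun x : ℝ => a * ex (j * x)) volume 0 1 :=
      fun a j => (continuous_const.mul
        (continuous_ex.comp (continuous_const.mul continuous_id))).intervalIntegrable _ _
    simp_rw [h1]
    rw [intervalIntegral.integral_finsetSum fun n _ => Continuous.intervalIntegrable ?_ _ _]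
    · rw [Complex.ofReal_sum]
      refine Finset.sum_congr rfl fun n hn => ?_
      rw [intervalIntegral.integral_finsetSum fun m _ => hc _ _]
      simp_rw [intervalIntegral.integral_const_mul, integral_ex_int, sub_eq_zero]
      simp [hn, Complex.mul_conj']
    · exact continuous_finsetSum _ fun m _ => continuous_const.mul
        (continuous_ex.comp (continuous_const.mul continuous_id))
  exact_mod_cast h

/-- The T T* step: pairing F with g gives ∑ f(n) c(n), where c(n) are Fourier coefficients of g.
Cauchy–Schwarz with weights ν leaves ∑ ν(n) |c(n)|², a double integral of g(x) and conj g(y) against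
the transform of ν at x - y. Only the majorant survives, and `k` bounds its transform. -/
lemma norm_integral_trigSum_mul_sq_le (s : Finset ℤ) (f : ℤ → ℂ) (ν : ℤ → ℝ) (k : ℝ → ℝ)
    (M : ℝ) (g : ℝ → ℂ) (hf : ∀ n ∈ s, ‖f n‖ ≤ ν n) (hk : Continuous k)
    (hν : ∀ x, ‖trigSum s (fun n => (ν n : ℂ)) x‖ ≤ k x) (hM : ∑ n ∈ s, ν n ≤ M)
    (hg : Continuous g) :
    ‖∫ x in (0 : ℝ)..1, trigSum s f x * g x‖ ^ 2 ≤
      M * ∫ x in (0 : ℝ)..1, ‖g x‖ * ∫ y in (0 : ℝ)..1, ‖g y‖ * k (x - y) := by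
  have hν0 : ∀ n ∈ s, 0 ≤ ν n := fun n hn => (norm_nonneg _).trans (hf n hn)
  have hcex : ∀ a : ℝ, Continuous fun x : ℝ => ex (a * x) := fun a =>
    continuous_ex.comp (continuous_const.mul continuous_id)
  set c : ℤ → ℂ := fun n => ∫ x in (0 : ℝ)..1, g x * ex (n * x) with hc
  have h1 : ∫ x in (0 : ℝ)..1, trigSum s f x * g x = ∑ n ∈ s, f n * c n := by
    have : ∀ x : ℝ, trigSum s f x * g x = ∑ n ∈ s, f n * (g x * ex (n * x)) := fun x => by
      rw [trigSum, Finset.sum_mul]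
      exact Finset.sum_congr rfl fun n _ => by ring
    simp_rw [this]
    rw [intervalIntegral.integral_finsetSum fun n _ => Continuous.intervalIntegrable ?_ _ _]
    · simp_rw [intervalIntegral.integral_const_mul, hc]
    · exact continuous_const.mul (hg.mul (hcex n))
  have h2 : ‖∑ n ∈ s, f n * c n‖ ≤ ∑ n ∈ s, ν n * ‖c n‖ := by
    refine (norm_sum_le _ _).trans (Finset.sum_le_sum fun n hn => ?_)
    rw [norm_mul]
    exact mul_le_mul_of_nonneg_right (hf n hn) (norm_nonneg _)
  have h3 : (∑ n ∈ s, ν n * ‖c n‖) ^ 2 ≤ (∑ n ∈ s, ν n) * ∑ n ∈ s, ν n * ‖c n‖ ^ 2 :=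
    Finset.sum_sq_le_sum_mul_sum_of_sq_le_mul s hν0
      (fun n hn => mul_nonneg (hν0 n hn) (sq_nonneg _)) (fun n _ => le_of_eq (by ring))
  have hconj : ∀ n : ℤ, (starRingEnd ℂ) (c n) =
      ∫ y in (0 : ℝ)..1, (starRingEnd ℂ) (g y) * ex (-(n * y)) := fun n => by
    rw [hc, ← intervalIntegral_conj]
    simp_rw [map_mul, conj_ex]
  have hin : Continuous fun x : ℝ => ∫ y in (0 : ℝ)..1, (starRingEnd ℂ) (g y) *
      trigSum s (fun n => (ν n : ℂ)) (x - y) := by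
    apply continuous_parametric_intervalIntegral_of_continuous'
    exact (Complex.continuous_conj.comp (hg.comp continuous_snd)).mul
      ((continuous_trigSum _ _).comp (continuous_fst.sub continuous_snd))
  have hin2 : Continuous fun x : ℝ => ∫ y in (0 : ℝ)..1, ‖g y‖ * k (x - y) := by
    apply continuous_parametric_intervalIntegral_of_continuous'
    exact (hg.norm.comp continuous_snd).mul (hk.comp (continuous_fst.sub continuous_snd))
  have h4 : ((∑ n ∈ s, ν n * ‖c n‖ ^ 2 : ℝ) : ℂ) = ∫ x in (0 : ℝ)..1, g x *
      ∫ y in (0 : ℝ)..1, (starRingEnd ℂ) (g y) * trigSum s (fun n => (ν n : ℂ)) (x - y) := by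
    have e1 : ∀ x : ℝ, ∫ y in (0 : ℝ)..1, (starRingEnd ℂ) (g y) *
        trigSum s (fun n => (ν n : ℂ)) (x - y) =
        ∑ n ∈ s, (ν n : ℂ) * ex (n * x) * (starRingEnd ℂ) (c n) := fun x => by
      have : ∀ y : ℝ, (starRingEnd ℂ) (g y) * trigSum s (fun n => (ν n : ℂ)) (x - y) =
          ∑ n ∈ s, (ν n : ℂ) * ex (n * x) * ((starRingEnd ℂ) (g y) * ex (-(n * y))) :=
        fun y => by
          rw [trigSum, Finset.mul_sum]
          refine Finset.sum_congr rfl fun n _ => ?_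
          rw [mul_sub, sub_eq_add_neg, ex_add]; ring
      simp_rw [this]
      rw [intervalIntegral.integral_finsetSum fun n _ => Continuous.intervalIntegrable ?_ _ _]
      · simp_rw [intervalIntegral.integral_const_mul, hconj]
      · exact continuous_const.mul ((Complex.continuous_conj.comp hg).mul
          (continuous_ex.comp (continuous_const.mul continuous_id).neg))
    simp_rw [e1, Finset.mul_sum]
    rw [intervalIntegral.integral_finsetSum fun n _ => Continuous.intervalIntegrable ?_ _ _]
    · push_cast
      refine Finset.sum_congr rfl fun n _ => ?_
      have : ∀ x : ℝ, g x * ((ν n : ℂ) * ex (n * x) * (starRingEnd ℂ) (c n)) =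
          (ν n : ℂ) * (starRingEnd ℂ) (c n) * (g x * ex (n * x)) := fun x => by ring
      simp_rw [this]
      rw [intervalIntegral.integral_const_mul, ← Complex.mul_conj']
      simp only [hc]
      ring
    · exact hg.mul ((continuous_const.mul (hcex n)).mul continuous_const)
  have h5 : ∑ n ∈ s, ν n * ‖c n‖ ^ 2 ≤
      ∫ x in (0 : ℝ)..1, ‖g x‖ * ∫ y in (0 : ℝ)..1, ‖g y‖ * k (x - y) := by
    have hnn : 0 ≤ ∑ n ∈ s, ν n * ‖c n‖ ^ 2 :=
      Finset.sum_nonneg fun n hn => mul_nonneg (hν0 n hn) (sq_nonneg _)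
    have e := congrArg norm h4
    rw [Complex.norm_real, Real.norm_of_nonneg hnn] at e
    rw [e]
    refine (intervalIntegral.norm_integral_le_integral_norm zero_le_one).trans ?_
    refine intervalIntegral.integral_mono_on zero_le_one
      ((hg.mul hin).norm.intervalIntegrable _ _)
      ((hg.norm.mul hin2).intervalIntegrable _ _) fun x _ => ?_
    rw [norm_mul]
    refine mul_le_mul_of_nonneg_left ?_ (norm_nonneg _)
    refine (intervalIntegral.norm_integral_le_integral_norm zero_le_one).trans ?_
    refine intervalIntegral.integral_mono_on zero_le_one (Continuous.intervalIntegrable ?_ _ _)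
      (Continuous.intervalIntegrable ?_ _ _) fun y _ => ?_
    · exact ((Complex.continuous_conj.comp hg).mul
        ((continuous_trigSum _ _).comp (continuous_const.sub continuous_id))).norm
    · exact hg.norm.mul (hk.comp (continuous_const.sub continuous_id))
    · rw [norm_mul, RCLike.norm_conj]
      exact mul_le_mul_of_nonneg_left (hν _) (norm_nonneg _)
  rw [h1]
  calc ‖∑ n ∈ s, f n * c n‖ ^ 2 ≤ (∑ n ∈ s, ν n * ‖c n‖) ^ 2 :=
        pow_le_pow_left₀ (norm_nonneg _) h2 2
    _ ≤ (∑ n ∈ s, ν n) * ∑ n ∈ s, ν n * ‖c n‖ ^ 2 := h3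
    _ ≤ M * _ := mul_le_mul hM h5
        (Finset.sum_nonneg fun n hn => mul_nonneg (hν0 n hn) (sq_nonneg _))
        ((Finset.sum_nonneg hν0).trans hM)

/-! ### Young's inequality and the restriction estimate. -/

/-- Weighted AM–GM with weights 1 - 2/u, 1/u, 1/u. With J the integral of p and K bounding that of
k^(u/2), each of the three means has double integral at most 1, so integrating this pointwise bound
yields Young's inequality. -/
lemma rpow_mul_rpow_mul_le {u p q k J K : ℝ} (hu : 2 < u) (hp : 0 ≤ p) (hq : 0 ≤ q) (hk : 0 ≤ k)
    (hJ : 0 < J) (hK : 0 < K) :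
    p ^ (1 - 1 / u) * (q ^ (1 - 1 / u) * k) ≤ J ^ (2 - 2 / u) * K ^ (2 / u) *
      ((1 - 2 / u) * (p * q / J ^ 2) + 1 / u * (p * k ^ (u / 2) / (J * K)) +
        1 / u * (q * k ^ (u / 2) / (J * K))) := by
  have hu0 : 0 < u := by linarith
  have h2u : 2 / u < 1 := by rw [div_lt_one hu0]; exact hu
  have h1u : 1 / u < 1 := by rw [div_lt_one hu0]; linarith
  have hne : 1 - 1 / u ≠ 0 := by linarith
  have hrhs : 0 ≤ J ^ (2 - 2 / u) * K ^ (2 / u) *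
      ((1 - 2 / u) * (p * q / J ^ 2) + 1 / u * (p * k ^ (u / 2) / (J * K)) +
        1 / u * (q * k ^ (u / 2) / (J * K))) := by
    have : 0 ≤ 1 - 2 / u := by linarith
    positivity
  rcases hp.eq_or_lt with rfl | hp
  · rw [Real.zero_rpow hne, zero_mul]; exact hrhs
  rcases hq.eq_or_lt with rfl | hq
  · rw [Real.zero_rpow hne, zero_mul, mul_zero]; exact hrhs
  have h := Real.geom_mean_le_arith_mean3_weighted (w₁ := 1 - 2 / u) (w₂ := 1 / u) (w₃ := 1 / u)
    (p₁ := p * q / J ^ 2) (p₂ := p * k ^ (u / 2) / (J * K)) (p₃ := q * k ^ (u / 2) / (J * K))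
    (by linarith) (by positivity) (by positivity) (by positivity) (by positivity) (by positivity)
    (by ring)
  refine le_trans (le_of_eq ?_) (mul_le_mul_of_nonneg_left h (by positivity))
  have hk1 : (k ^ (u / 2)) ^ (1 / u) * (k ^ (u / 2)) ^ (1 / u) = k := by
    rw [← Real.rpow_mul hk, ← Real.rpow_add' hk]
    · have : u / 2 * (1 / u) + u / 2 * (1 / u) = 1 := by field_simp; norm_num
      rw [this, Real.rpow_one]
    · have : u / 2 * (1 / u) + u / 2 * (1 / u) = 1 := by field_simp; norm_num
      rw [this]; norm_num
  have hsplit : ∀ x : ℝ, 0 < x → x ^ (1 - 1 / u) = x ^ (1 - 2 / u) * x ^ (1 / u) := fun x hx => by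
    rw [← Real.rpow_add hx]; congr 1; ring
  have hJ2 : J ^ (2 - 2 / u) = (J ^ (1 - 2 / u)) ^ 2 * (J ^ (1 / u)) ^ 2 := by
    rw [← mul_pow, ← Real.rpow_add hJ, ← Real.rpow_natCast, ← Real.rpow_mul hJ.le]
    congr 1; push_cast; ring
  have hK2 : K ^ (2 / u) = (K ^ (1 / u)) ^ 2 := by
    rw [← Real.rpow_natCast, ← Real.rpow_mul hK.le]
    congr 1; push_cast; ring
  have hkn : 0 ≤ k ^ (u / 2) := by positivity
  rw [Real.div_rpow (by positivity) (by positivity), Real.div_rpow (by positivity) (by positivity),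
    Real.div_rpow (by positivity) (by positivity), Real.mul_rpow hp.le hq.le,
    Real.mul_rpow hp.le hkn, Real.mul_rpow hq.le hkn, Real.mul_rpow hJ.le hK.le,
    hsplit p hp, hsplit q hq, hJ2, hK2, pow_two J, Real.mul_rpow hJ.le hJ.le]
  have a1 : 0 < J ^ (1 - 2 / u) := by positivity
  have a2 : 0 < J ^ (1 / u) := by positivity
  have a3 : 0 < K ^ (1 / u) := by positivity
  generalize (k ^ (u / 2)) ^ (1 / u) = r at hk1 ⊢
  rw [← hk1]
  field_simp

lemma integral_sub_left_of_periodic (k : ℝ → ℝ) (hper : Function.Periodic k 1) (x : ℝ) :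
    ∫ y in (0 : ℝ)..1, k (x - y) = ∫ y in (0 : ℝ)..1, k y := by
  rw [intervalIntegral.integral_comp_sub_left (fun y => k y) x]
  have := hper.intervalIntegral_add_eq (x - 1) 0
  simpa using this

lemma integral_sub_right_of_periodic (k : ℝ → ℝ) (hper : Function.Periodic k 1) (y : ℝ) :
    ∫ x in (0 : ℝ)..1, k (x - y) = ∫ y in (0 : ℝ)..1, k y := by
  rw [intervalIntegral.integral_comp_sub_right (fun y => k y) y]
  have := hper.intervalIntegral_add_eq (-y) 0
  simpa [add_comm, sub_eq_add_neg] using this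

/-- A form of Young's convolution inequality on the circle. -/
lemma integral_rpow_mul_integral_rpow_mul_le {u K : ℝ} (hu : 2 < u) (hK : 0 < K) (p k : ℝ → ℝ)
    (hp : Continuous p) (hp0 : ∀ x, 0 ≤ p x) (hk : Continuous k) (hk0 : ∀ x, 0 ≤ k x)
    (hper : Function.Periodic k 1) (hkK : ∫ x in (0 : ℝ)..1, k x ^ (u / 2) ≤ K)
    (hJ : 0 < ∫ x in (0 : ℝ)..1, p x) :
    ∫ x in (0 : ℝ)..1, p x ^ (1 - 1 / u) *
        ∫ y in (0 : ℝ)..1, p y ^ (1 - 1 / u) * k (x - y) ≤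
      (∫ x in (0 : ℝ)..1, p x) ^ (2 - 2 / u) * K ^ (2 / u) := by
  set J := ∫ x in (0 : ℝ)..1, p x with hJdef
  have hu0 : 0 < u := by linarith
  have h1u : 0 < 1 - 1 / u := by rw [sub_pos, div_lt_one hu0]; linarith
  set κ : ℝ → ℝ := fun x => k x ^ (u / 2) with hκ
  have hκc : Continuous κ := hk.rpow_const fun x => Or.inr (by linarith)
  have hκper : Function.Periodic κ 1 := fun x => by simp only [hκ, hper x]
  have hpc : Continuous fun x => p x ^ (1 - 1 / u) := hp.rpow_const fun x => Or.inr h1u.le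
  have hin : ∀ h : ℝ → ℝ, Continuous h → ∀ k : ℝ → ℝ, Continuous k →
      Continuous fun x : ℝ => ∫ y in (0 : ℝ)..1, h y * k (x - y) := fun h hh k hk => by
    apply continuous_parametric_intervalIntegral_of_continuous'
    exact (hh.comp continuous_snd).mul (hk.comp (continuous_fst.sub continuous_snd))
  set A := J ^ (2 - 2 / u) * K ^ (2 / u) with hA
  have hA0 : 0 < A := by positivity
  have hsw : ∫ x in (0 : ℝ)..1, ∫ y in (0 : ℝ)..1, p y * κ (x - y) ≤ J * K := by
    rw [intervalIntegral_intervalIntegral_swap]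
    · simp_rw [intervalIntegral.integral_const_mul, integral_sub_right_of_periodic κ hκper]
      rw [intervalIntegral.integral_mul_const]
      exact mul_le_mul_of_nonneg_left hkK hJ.le
    · have : Continuous (Function.uncurry fun x y : ℝ => p y * κ (x - y)) :=
        (hp.comp continuous_snd).mul (hκc.comp (continuous_fst.sub continuous_snd))
      refine IntegrableOn.mono_set (this.continuousOn.integrableOn_compact
        (isCompact_uIcc.prod isCompact_uIcc)) (Set.prod_mono Set.uIoc_subset_uIcc
          Set.uIoc_subset_uIcc)
  have hpt : ∀ x, p x ^ (1 - 1 / u) * ∫ y in (0 : ℝ)..1, p y ^ (1 - 1 / u) * k (x - y) ≤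
      A * ((1 - 2 / u) * (p x / J) + 1 / u * (p x / J) +
        1 / u * (1 / (J * K)) * ∫ y in (0 : ℝ)..1, p y * κ (x - y)) := by
    intro x
    have hκx : Continuous fun y => κ (x - y) := hκc.comp (continuous_const.sub continuous_id)
    have hkx : Continuous fun y => k (x - y) := hk.comp (continuous_const.sub continuous_id)
    rw [← intervalIntegral.integral_const_mul]
    have hle : ∫ y in (0 : ℝ)..1, p x ^ (1 - 1 / u) * (p y ^ (1 - 1 / u) * k (x - y)) ≤
        ∫ y in (0 : ℝ)..1, (A * (1 - 2 / u) * p x / J ^ 2 * p y +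
          A * (1 / u) * p x / (J * K) * κ (x - y) +
          A * (1 / u) / (J * K) * (p y * κ (x - y))) := by
      refine intervalIntegral.integral_mono_on zero_le_one
        ((continuous_const.mul (hpc.mul hkx)).intervalIntegrable _ _)
        ((((continuous_const.mul hp).add (continuous_const.mul hκx)).add
          (continuous_const.mul (hp.mul hκx))).intervalIntegrable _ _) fun y _ => ?_
      refine (rpow_mul_rpow_mul_le hu (hp0 x) (hp0 y) (hk0 (x - y)) hJ hK).trans (le_of_eq ?_)
      simp only [hκ]
      rw [← hA]
      ring
    refine hle.trans ?_
    rw [integral_add_of_continuous ?_ ?_, integral_add_of_continuous ?_ ?_,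
      intervalIntegral.integral_const_mul, intervalIntegral.integral_const_mul,
      intervalIntegral.integral_const_mul, integral_sub_left_of_periodic κ hκper, ← hJdef]
    · have h1 : A * (1 / u) * p x / (J * K) * ∫ y in (0 : ℝ)..1, κ y ≤
          A * (1 / u) * p x / (J * K) * K := by
        refine mul_le_mul_of_nonneg_left hkK ?_
        have := hp0 x
        positivity
      have e1 : A * (1 / u) * p x / (J * K) * K = A * (1 / u * (p x / J)) := by field_simp
      have e2 : A * (1 - 2 / u) * p x / J ^ 2 * J = A * ((1 - 2 / u) * (p x / J)) := by field_simp
      rw [e1] at h1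
      rw [e2]
      have e3 : A * (1 / u) / (J * K) * ∫ y in (0 : ℝ)..1, p y * κ (x - y) =
        A * (1 / u * (1 / (J * K)) * ∫ y in (0 : ℝ)..1, p y * κ (x - y)) := by ring
      linarith
    all_goals fun_prop
  have hfin : ∫ x in (0 : ℝ)..1, p x ^ (1 - 1 / u) *
        ∫ y in (0 : ℝ)..1, p y ^ (1 - 1 / u) * k (x - y) ≤
      ∫ x in (0 : ℝ)..1, (A * ((1 - 2 / u) + 1 / u) / J * p x +
        A * (1 / u) / (J * K) * ∫ y in (0 : ℝ)..1, p y * κ (x - y)) := by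
    refine intervalIntegral.integral_mono_on zero_le_one
      ((hpc.mul (hin _ hpc _ hk)).intervalIntegrable _ _)
      (((continuous_const.mul hp).add
        (continuous_const.mul (hin _ hp _ hκc))).intervalIntegrable _ _) fun x _ => ?_
    refine (hpt x).trans (le_of_eq ?_)
    ring
  refine hfin.trans ?_
  rw [integral_add_of_continuous ?_ ?_,
    intervalIntegral.integral_const_mul, intervalIntegral.integral_const_mul, ← hJdef]
  · have h2 := mul_le_mul_of_nonneg_left hsw (a := A * (1 / u) / (J * K)) (by positivity)
    have e1 : A * (1 / u) / (J * K) * (J * K) = A * (1 / u) := by field_simp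
    have e2 : A * ((1 - 2 / u) + 1 / u) / J * J = A * ((1 - 2 / u) + 1 / u) := by field_simp
    rw [e1] at h2
    rw [e2]
    have e3 : A * ((1 - 2 / u) + 1 / u) + A * (1 / u) = A := by ring
    linarith
  · exact continuous_const.mul hp
  · exact continuous_const.mul (hin _ hp _ hκc)

/-- A restriction estimate of Stein–Tomas type for functions with a pseudorandom majorant. -/
theorem integral_norm_trigSum_rpow_le {u M D K : ℝ} (hu : 2 < u) (hM : 0 < M) (hD : 0 < D)
    (hK : 0 < K) (s : Finset ℤ) (f : ℤ → ℂ) (ν : ℤ → ℝ) (k : ℝ → ℝ)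
    (hf : ∀ n ∈ s, ‖f n‖ ≤ ν n) (hk : Continuous k) (hk0 : ∀ x, 0 ≤ k x)
    (hper : Function.Periodic k 1)
    (hν : ∀ x, ‖trigSum s (fun n => (ν n : ℂ)) x‖ ≤ k x + D) (hνM : ∑ n ∈ s, ν n ≤ M)
    (hkK : ∫ x in (0 : ℝ)..1, k x ^ (u / 2) ≤ K) :
    ∫ x in (0 : ℝ)..1, ‖trigSum s f x‖ ^ u ≤
      (2 * M) ^ (u / 2) * K + (2 * M * D) ^ ((u - 2) / 2) * ∑ n ∈ s, ‖f n‖ ^ 2 := by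
  set F := trigSum s f with hF
  have hFc : Continuous F := continuous_trigSum s f
  have hu0 : 0 < u := by linarith
  -- The threshold is chosen so that the contribution of D, at most MD (J/B)², is exactly J²/2 and
  -- can be absorbed.
  set B := √(2 * M * D) with hB
  have hB0 : 0 < B := Real.sqrt_pos.2 (by positivity)
  have hB2 : B ^ 2 = 2 * M * D := Real.sq_sqrt (by positivity)
  have hBu : B ^ (u - 2) = (2 * M * D) ^ ((u - 2) / 2) := by
    rw [hB, Real.sqrt_eq_rpow, ← Real.rpow_mul (by positivity)]; congr 1; ring
  -- A continuous substitute for cutting off to |F| > B: it vanishes where |F| ≤ B and falls short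
  -- of |F|^(u-2) by at most B^(u-2).
  set t : ℝ → ℝ := fun x => max (‖F x‖ ^ (u - 2) - B ^ (u - 2)) 0 with ht
  have htc : Continuous t := by
    refine Continuous.max ((hFc.norm.rpow_const fun x => Or.inr (by linarith)).sub
      continuous_const) continuous_const
  have ht0 : ∀ x, 0 ≤ t x := fun x => le_max_right _ _
  have htle : ∀ x, t x ≤ ‖F x‖ ^ (u - 2) := fun x => by
    refine max_le ?_ (by positivity)
    have : 0 < B ^ (u - 2) := by positivity
    linarith
  set p : ℝ → ℝ := fun x => ‖F x‖ ^ 2 * t x with hp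
  have hpc : Continuous p := (hFc.norm.pow 2).mul htc
  have hp0 : ∀ x, 0 ≤ p x := fun x => mul_nonneg (sq_nonneg _) (ht0 x)
  set g : ℝ → ℂ := fun x => (t x : ℂ) * (starRingEnd ℂ) (F x) with hg
  have hgc : Continuous g :=
    (Complex.continuous_ofReal.comp htc).mul (Complex.continuous_conj.comp hFc)
  have hgn : ∀ x, ‖g x‖ = ‖F x‖ * t x := fun x => by
    rw [hg]; simp only
    rw [norm_mul, RCLike.norm_conj, Complex.norm_real, Real.norm_of_nonneg (ht0 x), mul_comm]
  have hgB : ∀ x, ‖g x‖ ≤ p x / B := fun x => by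
    rw [hgn, le_div_iff₀ hB0, hp]
    rcases (ht0 x).eq_or_lt with h | h
    · simp only; rw [← h]; simp
    · have h1 : B ^ (u - 2) < ‖F x‖ ^ (u - 2) := by
        rcases lt_max_iff.1 h with h | h
        · linarith
        · exact absurd h (lt_irrefl _)
      have h2 : B < ‖F x‖ := (Real.rpow_lt_rpow_iff hB0.le (norm_nonneg _) (by linarith)).1 h1
      have h3 : 0 ≤ ‖F x‖ * t x := mul_nonneg (norm_nonneg _) h.le
      simp only
      nlinarith
  -- Writing t = t^(1-1/u) t^(1/u) and using t ≤ |F|^(u-2) on the second factor turns |F| t into at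
  -- most (|F|² t)^(1-1/u), the power that Young's inequality takes.
  have hgp : ∀ x, ‖g x‖ ≤ p x ^ (1 - 1 / u) := fun x => by
    rw [hgn, hp]
    rcases (ht0 x).eq_or_lt with h | h
    · rw [← h, mul_zero]; positivity
    rcases (norm_nonneg (F x)).eq_or_lt with h' | h'
    · rw [← h', zero_mul]; positivity
    have e1 : (‖F x‖ ^ 2 * t x) ^ (1 - 1 / u) = ‖F x‖ ^ (2 - 2 / u) * t x ^ (1 - 1 / u) := by
      rw [Real.mul_rpow (by positivity) h.le, ← Real.rpow_natCast, ← Real.rpow_mul h'.le]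
      congr 2; push_cast; ring
    have e2 : t x = t x ^ (1 - 1 / u) * t x ^ (1 / u) := by
      rw [← Real.rpow_add h, sub_add_cancel, Real.rpow_one]
    have e3 : t x ^ (1 / u) ≤ ‖F x‖ ^ (1 - 2 / u) := by
      refine (Real.rpow_le_rpow h.le (htle x) (by positivity)).trans (le_of_eq ?_)
      rw [← Real.rpow_mul h'.le]
      congr 1; field_simp
    have e4 : ‖F x‖ ^ (2 - 2 / u) = ‖F x‖ * ‖F x‖ ^ (1 - 2 / u) := by
      nth_rewrite 2 [← Real.rpow_one ‖F x‖]
      rw [← Real.rpow_add h']; congr 1; ring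
    simp only
    rw [e1, e4]
    nth_rewrite 1 [e2]
    have : 0 ≤ ‖F x‖ * t x ^ (1 - 1 / u) := by positivity
    nlinarith
  set J := ∫ x in (0 : ℝ)..1, p x with hJ
  have hJ0 : 0 ≤ J := intervalIntegral.integral_nonneg zero_le_one fun x _ => hp0 x
  have hFg : ∫ x in (0 : ℝ)..1, F x * g x = (J : ℂ) := by
    rw [hJ, ← intervalIntegral.integral_ofReal]
    congr 1; ext x
    simp only [hg, hp]
    push_cast
    rw [← Complex.mul_conj']; ring
  have hJK : J ≤ (2 * M) ^ (u / 2) * K := by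
    rcases hJ0.eq_or_lt with h | h
    · rw [← h]; positivity
    have hdual := norm_integral_trigSum_mul_sq_le s f ν (fun x => k x + D) M g hf
      (hk.add continuous_const) hν hνM hgc
    rw [← hF, hFg, Complex.norm_real, Real.norm_of_nonneg hJ0] at hdual
    have hin : ∀ h : ℝ → ℝ, Continuous h →
        Continuous fun x : ℝ => ∫ y in (0 : ℝ)..1, h y * k (x - y) := fun h hh => by
      apply continuous_parametric_intervalIntegral_of_continuous'
      exact (hh.comp continuous_snd).mul (hk.comp (continuous_fst.sub continuous_snd))
    have hgi : ∫ x in (0 : ℝ)..1, ‖g x‖ ≤ J / B := by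
      rw [hJ, ← intervalIntegral.integral_div]
      exact intervalIntegral.integral_mono_on zero_le_one (hgc.norm.intervalIntegrable _ _)
        ((hpc.div_const _).intervalIntegrable _ _) fun x _ => hgB x
    have hgi0 : 0 ≤ ∫ x in (0 : ℝ)..1, ‖g x‖ :=
      intervalIntegral.integral_nonneg zero_le_one fun x _ => norm_nonneg _
    have hkx : ∀ x : ℝ, Continuous fun y => k (x - y) := fun x =>
      hk.comp (continuous_const.sub continuous_id)
    have hsplit : ∫ x in (0 : ℝ)..1, ‖g x‖ * ∫ y in (0 : ℝ)..1, ‖g y‖ * (k (x - y) + D) =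
        (∫ x in (0 : ℝ)..1, ‖g x‖ * ∫ y in (0 : ℝ)..1, ‖g y‖ * k (x - y)) +
          D * (∫ x in (0 : ℝ)..1, ‖g x‖) ^ 2 := by
      have : ∀ x : ℝ, ‖g x‖ * ∫ y in (0 : ℝ)..1, ‖g y‖ * (k (x - y) + D) =
          ‖g x‖ * (∫ y in (0 : ℝ)..1, ‖g y‖ * k (x - y)) +
          ‖g x‖ * ((∫ y in (0 : ℝ)..1, ‖g y‖) * D) := fun x => by
        simp_rw [mul_add]
        rw [integral_add_of_continuous ?_ ?_, intervalIntegral.integral_mul_const, mul_add]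
        · exact hgc.norm.mul (hkx x)
        · exact hgc.norm.mul continuous_const
      simp_rw [this]
      rw [integral_add_of_continuous ?_ ?_, intervalIntegral.integral_mul_const]
      · ring
      · exact hgc.norm.mul (hin _ hgc.norm)
      · exact hgc.norm.mul continuous_const
    have h1u : 0 < 1 - 1 / u := by rw [sub_pos, div_lt_one hu0]; linarith
    have hpu : Continuous fun x => p x ^ (1 - 1 / u) := hpc.rpow_const fun x => Or.inr h1u.le
    have hyoung : (∫ x in (0 : ℝ)..1, ‖g x‖ * ∫ y in (0 : ℝ)..1, ‖g y‖ * k (x - y)) ≤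
        J ^ (2 - 2 / u) * K ^ (2 / u) := by
      refine le_trans ?_ (integral_rpow_mul_integral_rpow_mul_le hu hK p k hpc hp0 hk hk0 hper
        hkK h)
      refine intervalIntegral.integral_mono_on zero_le_one
        ((hgc.norm.mul (hin _ hgc.norm)).intervalIntegrable _ _)
        ((hpu.mul (hin _ hpu)).intervalIntegrable _ _) fun x _ => ?_
      refine mul_le_mul (hgp x) ?_ (intervalIntegral.integral_nonneg zero_le_one fun y _ =>
        mul_nonneg (norm_nonneg _) (hk0 _)) (Real.rpow_nonneg (hp0 x) _)
      refine intervalIntegral.integral_mono_on zero_le_one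
        ((hgc.norm.mul (hkx x)).intervalIntegrable _ _)
        ((hpu.mul (hkx x)).intervalIntegrable _ _) fun y _ => ?_
      exact mul_le_mul_of_nonneg_right (hgp y) (hk0 _)
    rw [hsplit] at hdual
    have hsq : M * (D * (∫ x in (0 : ℝ)..1, ‖g x‖) ^ 2) ≤ J ^ 2 / 2 := by
      have h1 := pow_le_pow_left₀ hgi0 hgi 2
      rw [div_pow, hB2, le_div_iff₀ (by positivity)] at h1
      linarith
    have hmain : J ^ 2 ≤ 2 * M * (J ^ (2 - 2 / u) * K ^ (2 / u)) := by
      have := mul_le_mul_of_nonneg_left hyoung hM.le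
      rw [mul_add] at hdual
      linarith
    have hJsplit : J ^ 2 = J ^ (2 - 2 / u) * J ^ (2 / u) := by
      rw [← Real.rpow_add h, sub_add_cancel]; norm_num
    rw [hJsplit] at hmain
    have hlast : J ^ (2 / u) ≤ 2 * M * K ^ (2 / u) := by
      have : 0 < J ^ (2 - 2 / u) := by positivity
      refine le_of_mul_le_mul_left ?_ this
      linarith
    have hfinal := Real.rpow_le_rpow (by positivity) hlast (by positivity : 0 ≤ u / 2)
    have e : 2 / u * (u / 2) = 1 := by field_simp
    rw [← Real.rpow_mul hJ0, e, Real.rpow_one, Real.mul_rpow (by positivity) (by positivity),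
      ← Real.rpow_mul hK.le, e, Real.rpow_one] at hfinal
    exact hfinal
  have hle : ∫ x in (0 : ℝ)..1, ‖F x‖ ^ u ≤
      ∫ x in (0 : ℝ)..1, (p x + B ^ (u - 2) * ‖F x‖ ^ 2) := by
    refine intervalIntegral.integral_mono_on zero_le_one
      ((hFc.norm.rpow_const fun x => Or.inr hu0.le).intervalIntegrable _ _)
      ((hpc.add (continuous_const.mul (hFc.norm.pow 2))).intervalIntegrable _ _) fun x _ => ?_
    have e : ‖F x‖ ^ u = ‖F x‖ ^ 2 * ‖F x‖ ^ (u - 2) := by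
      rw [← Real.rpow_natCast, ← Real.rpow_add' (norm_nonneg _)]
      · congr 1; push_cast; ring
      · push_cast; linarith
    have h1 : ‖F x‖ ^ (u - 2) ≤ t x + B ^ (u - 2) := by
      have := le_max_left (‖F x‖ ^ (u - 2) - B ^ (u - 2)) 0
      simp only [ht]
      linarith
    rw [e]
    have := mul_le_mul_of_nonneg_left h1 (sq_nonneg ‖F x‖)
    simp only [hp]
    linarith
  rw [integral_add_of_continuous ?_ ?_, intervalIntegral.integral_const_mul, hF,
    integral_norm_trigSum_sq, hBu] at hle
  · linarith
  · exact hpc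
  · exact continuous_const.mul (hFc.norm.pow 2)

/-! ### Exponential sums with phase h m^γ along m = W n - b. -/

lemma sum_eq_sum_range_of_ordConnected (s : Finset ℤ)
    (hs : ∀ a ∈ s, ∀ c ∈ s, ∀ b, a ≤ b → b ≤ c → b ∈ s) :
    ∃ (n : ℤ) (L : ℕ), L = s.card ∧ (∀ i < L, n + (i : ℤ) ∈ s) ∧ ∀ F : ℤ → ℂ,
      ∑ m ∈ s, F m = ∑ i ∈ Finset.range L, F (n + i) := by
  rcases s.eq_empty_or_nonempty with h | h
  · exact ⟨0, 0, by simp [h], by simp, fun F => by simp [h]⟩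
  have hset : s = Finset.Icc (s.min' h) (s.max' h) := by
    ext i
    rw [Finset.mem_Icc]
    exact ⟨fun hi => ⟨Finset.min'_le s _ hi, Finset.le_max' s _ hi⟩,
      fun hi => hs _ (Finset.min'_mem s h) _ (Finset.max'_mem s h) _ hi.1 hi.2⟩
  have hcard : s.card = (s.max' h + 1 - s.min' h).toNat := by
    conv_lhs => rw [hset]
    exact Int.card_Icc _ _
  refine ⟨s.min' h, s.card, rfl, fun i hi => ?_, fun F => ?_⟩
  · exact hset.ge (Finset.mem_Icc.2 ⟨by omega, by omega⟩)
  · conv_lhs => rw [hset]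
    rw [Int.Icc_eq_finset_map, Finset.sum_map, hcard]
    rfl

/-- The second difference of a function with positive step, as a value of the second
derivative. -/
lemma exists_second_difference_eq {f f' f'' : ℝ → ℝ} {x w : ℝ} (hw : 0 < w)
    (h1 : ∀ y, x ≤ y → HasDerivAt f (f' y) y) (h2 : ∀ y, x ≤ y → HasDerivAt f' (f'' y) y) :
    ∃ y, x ≤ y ∧ y ≤ x + 2 * w ∧ f (x + 2 * w) - 2 * f (x + w) + f x = w ^ 2 * f'' y := by
  -- The mean value theorem is used twice: on y ↦ f(y + w) - f(y) over [x, x + w], then on f' over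
  -- an interval of length w.
  have hG : ∀ y, x ≤ y → HasDerivAt (fun y => f (y + w) - f y) (f' (y + w) - f' y) y :=
    fun y hy => ((h1 (y + w) (by linarith)).comp_add_const y w).sub (h1 y hy)
  obtain ⟨a, ha, ha'⟩ := exists_hasDerivAt_eq_slope (fun y => f (y + w) - f y)
    (fun y => f' (y + w) - f' y) (by linarith : x < x + w)
    (fun y hy => (hG y hy.1).continuousAt.continuousWithinAt) (fun y hy => hG y hy.1.le)
  obtain ⟨d, hd, hd'⟩ := exists_hasDerivAt_eq_slope f' f'' (by linarith : a < a + w)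
    (fun y hy => (h2 y (ha.1.le.trans hy.1)).continuousAt.continuousWithinAt)
    (fun y hy => h2 y (ha.1.le.trans hy.1.le))
  refine ⟨d, by linarith [ha.1, hd.1], by linarith [ha.2, hd.2], ?_⟩
  rw [eq_div_iff (by linarith)] at ha' hd'
  have e1 : x + w + w = x + 2 * w := by ring
  rw [e1] at ha'
  linear_combination (-1) * ha' - w * hd'

/-- The negative sign makes the function convex, as the second difference test requires. Its second
derivative decreases, so the extreme values are at the ends of [x, x + 2w]. -/
lemma second_difference_neg_rpow {γ x w : ℝ} (h0 : 0 < γ) (h1 : γ < 1) (hx : 0 < x)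
    (hw : 0 < w) :
    γ * (1 - γ) * w ^ 2 * (x + 2 * w) ^ (γ - 2) ≤
        -(x + 2 * w) ^ γ - 2 * -(x + w) ^ γ + -x ^ γ ∧
      -(x + 2 * w) ^ γ - 2 * -(x + w) ^ γ + -x ^ γ ≤ γ * (1 - γ) * w ^ 2 * x ^ (γ - 2) := by
  obtain ⟨y, hy1, hy2, hy⟩ := exists_second_difference_eq (f := fun y => -y ^ γ)
    (f' := fun y => -(γ * y ^ (γ - 1))) (f'' := fun y => γ * (1 - γ) * y ^ (γ - 2)) (x := x) hw
    (fun y hy => (Real.hasDerivAt_rpow_const (Or.inl (by linarith))).neg)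
    (fun y hy => by
      have := ((Real.hasDerivAt_rpow_const (x := y) (p := γ - 1)
        (Or.inl (by linarith))).const_mul γ).neg
      have e : γ - 1 - 1 = γ - 2 := by ring
      rw [e] at this
      exact this.congr_deriv (by ring))
  have hc : 0 ≤ γ * (1 - γ) * w ^ 2 := by
    have : 0 < 1 - γ := by linarith
    positivity
  rw [hy]
  have e : w ^ 2 * (γ * (1 - γ) * y ^ (γ - 2)) = γ * (1 - γ) * w ^ 2 * y ^ (γ - 2) := by ring
  rw [e]
  exact ⟨mul_le_mul_of_nonneg_left
      (Real.rpow_le_rpow_of_nonpos (by linarith) hy2 (by linarith)) hc,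
    mul_le_mul_of_nonneg_left (Real.rpow_le_rpow_of_nonpos hx hy1 (by linarith)) hc⟩

/-- The exponential sum over a dyadic piece of an arithmetic progression, with one sign of the
nonlinear phase. -/
lemma norm_sum_ex_neg_rpow_le {γ : ℝ} (h0 : 0 < γ) (h1 : γ < 1) (W b Y : ℕ) (hW : 1 ≤ W)
    (hY : 1 ≤ Y) (t : Finset ℤ) (ht : ∀ a ∈ t, ∀ c ∈ t, ∀ b, a ≤ b → b ≤ c → b ∈ t)
    (htY : ∀ n ∈ t, (Y : ℤ) ≤ W * n - b ∧ (W : ℤ) * n - b < 2 * Y) (h : ℕ) (hh : 1 ≤ h)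
    (hhY : (h : ℝ) ≤ (Y : ℝ) ^ (1 - γ)) (x : ℝ) :
    ‖∑ n ∈ t, ex (h * -(((W : ℤ) * n - b : ℤ) : ℝ) ^ γ + n * x)‖ ≤
      32 / √(γ * (1 - γ)) * (W : ℝ) ^ 2 *
        (√h * (Y : ℝ) ^ (γ / 2) + (Y : ℝ) ^ (1 - γ / 2) / √h) := by
  obtain ⟨n₀, L, -, hmem, hsum⟩ := sum_eq_sum_range_of_ordConnected t ht
  rw [hsum]
  set κ := γ * (1 - γ) with hκ
  have hκ0 : 0 < κ := mul_pos h0 (by linarith)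
  have hκ1 : κ ≤ 1 / 4 := by rw [hκ]; nlinarith [sq_nonneg (γ - 1 / 2)]
  have hW' : (1 : ℝ) ≤ W := by exact_mod_cast hW
  have hY' : (1 : ℝ) ≤ Y := by exact_mod_cast hY
  have hh' : (1 : ℝ) ≤ h := by exact_mod_cast hh
  have hY0 : (0 : ℝ) < Y := by linarith
  have hW0 : (0 : ℝ) < W := by linarith
  have hLY : (L : ℝ) ≤ Y := by
    rcases Nat.eq_zero_or_pos L with hL | hL
    · subst hL; simp
    · have a1 := htY _ (hmem 0 hL)
      have a2 := htY _ (hmem (L - 1) (by omega))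
      have a3 : ((L - 1 : ℕ) : ℤ) = L - 1 := by omega
      rw [a3] at a2
      have a4 : (W : ℤ) * (L - 1) < Y := by
        have := a1.1
        have := a2.2
        push_cast at *
        linarith
      have a5 : (L : ℤ) - 1 < Y := by
        have : (1 : ℤ) ≤ W := by exact_mod_cast hW
        nlinarith
      exact_mod_cast (by omega : L ≤ Y)
  set m : ℕ → ℝ := fun i => (W : ℝ) * (n₀ + i) - b with hm
  have hm1 : ∀ i < L, (Y : ℝ) ≤ m i ∧ m i < 2 * Y := fun i hi => by
    have := htY _ (hmem i hi)
    simp only [hm]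
    constructor
    · exact_mod_cast this.1
    · exact_mod_cast this.2
  -- The step W contributes W², while m + 2W ≤ 4WY and γ - 2 ≥ -2 cost at most (4W)², leaving the
  -- factor 1/16. The upper bound for the second differences is then 16 W² l.
  set l : ℝ := κ * h * (Y : ℝ) ^ (γ - 2) / 16 with hl
  have hYp : (0 : ℝ) < (Y : ℝ) ^ (γ - 2) := by positivity
  have hl0 : 0 < l := by positivity
  have hl1 : l ≤ 1 / 4 := by
    have a1 : (h : ℝ) * (Y : ℝ) ^ (γ - 2) ≤ 1 := by
      calc (h : ℝ) * (Y : ℝ) ^ (γ - 2) ≤ (Y : ℝ) ^ (1 - γ) * (Y : ℝ) ^ (γ - 2) :=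
            mul_le_mul_of_nonneg_right hhY hYp.le
        _ = (Y : ℝ) ^ (-1 : ℝ) := by rw [← Real.rpow_add hY0]; congr 1; ring
        _ ≤ 1 := Real.rpow_le_one_of_one_le_of_nonpos hY' (by norm_num)
    have : l = κ * (h * (Y : ℝ) ^ (γ - 2)) / 16 := by rw [hl]; ring
    rw [this]
    nlinarith
  have hdiff : ∀ i < L,
      (h * -(m (i + 2)) ^ γ + (n₀ + (i + 2 : ℕ)) * x) -
        2 * (h * -(m (i + 1)) ^ γ + (n₀ + (i + 1 : ℕ)) * x) +
        (h * -(m i) ^ γ + (n₀ + i) * x) =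
      h * (-(m i + 2 * W) ^ γ - 2 * -(m i + W) ^ γ + -(m i) ^ γ) := fun i _ => by
    have e2 : m (i + 2) = m i + 2 * W := by simp only [hm]; push_cast; ring
    have e1 : m (i + 1) = m i + W := by simp only [hm]; push_cast; ring
    rw [e2, e1]; push_cast; ring
  have hlow : ∀ i < L, l ≤ h * (-(m i + 2 * W) ^ γ - 2 * -(m i + W) ^ γ + -(m i) ^ γ) ∧
      h * (-(m i + 2 * W) ^ γ - 2 * -(m i + W) ^ γ + -(m i) ^ γ) ≤ 16 * W ^ 2 * l := by
    intro i hi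
    have hmi := hm1 i hi
    have hmpos : 0 < m i := by linarith
    have hsd := second_difference_neg_rpow h0 h1 hmpos hW0
    rw [← hκ] at hsd
    constructor
    · refine le_trans ?_ (mul_le_mul_of_nonneg_left hsd.1 (by linarith))
      have a1 : (4 * W * Y : ℝ) ^ (γ - 2) ≤ (m i + 2 * W) ^ (γ - 2) := by
        refine Real.rpow_le_rpow_of_nonpos (by positivity) ?_ (by linarith)
        nlinarith
      have a2 : (4 * W : ℝ) ^ (-2 : ℝ) ≤ (4 * W : ℝ) ^ (γ - 2) :=
        Real.rpow_le_rpow_of_exponent_le (by linarith) (by linarith)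
      have a3 : (4 * W : ℝ) ^ (-2 : ℝ) = 1 / (16 * W ^ 2) := by
        rw [Real.rpow_neg (by positivity)]
        norm_num
        ring
      rw [Real.mul_rpow (by positivity) hY0.le] at a1
      have a4 : 1 / (16 * (W : ℝ) ^ 2) * (Y : ℝ) ^ (γ - 2) ≤ (m i + 2 * W) ^ (γ - 2) := by
        rw [← a3]
        exact (mul_le_mul_of_nonneg_right a2 hYp.le).trans a1
      have a5 := mul_le_mul_of_nonneg_left a4 (by positivity : 0 ≤ h * (κ * (W : ℝ) ^ 2))
      refine le_trans (le_of_eq ?_) (a5.trans (le_of_eq (by ring)))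
      rw [hl]; field_simp
    · refine (mul_le_mul_of_nonneg_left hsd.2 (by linarith)).trans ?_
      have a1 : m i ^ (γ - 2) ≤ (Y : ℝ) ^ (γ - 2) :=
        Real.rpow_le_rpow_of_nonpos hY0 hmi.1 (by linarith)
      have a5 := mul_le_mul_of_nonneg_left a1 (by positivity : 0 ≤ h * (κ * (W : ℝ) ^ 2))
      refine le_trans (le_of_eq (by ring)) (a5.trans (le_of_eq ?_))
      rw [hl]; ring
  have hvdc := norm_sum_ex_le_of_second_difference
    (fun i => h * -(m i) ^ γ + (n₀ + i) * x) L l (16 * W ^ 2 * l) hl0 hl1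
    (fun i hi => by rw [hdiff i hi]; exact (hlow i hi).1)
    (fun i hi => by rw [hdiff i hi]; exact (hlow i hi).2)
  have hcast : ∑ i ∈ Finset.range L, ex (h * -(((W : ℤ) * (n₀ + i) - b : ℤ) : ℝ) ^ γ +
      ((n₀ + i : ℤ) : ℝ) * x) =
      ∑ i ∈ Finset.range L, ex (h * -(m i) ^ γ + (n₀ + i) * x) := by
    refine Finset.sum_congr rfl fun i _ => ?_
    simp only [hm]
    push_cast
    rfl
  rw [hcast]
  refine hvdc.trans ?_
  have hsl : √l = √κ * √h * (Y : ℝ) ^ (γ / 2 - 1) / 4 := by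
    have e16 : √(16 : ℝ) = 4 := by
      rw [show (16 : ℝ) = 4 ^ 2 by norm_num]; exact Real.sqrt_sq (by norm_num)
    have e1 : √((Y : ℝ) ^ (γ - 2)) = (Y : ℝ) ^ (γ / 2 - 1) := by
      rw [Real.sqrt_eq_rpow, ← Real.rpow_mul hY0.le]; congr 1; ring
    rw [hl, Real.sqrt_div (by positivity), Real.sqrt_mul (by positivity),
      Real.sqrt_mul (by positivity), e16, e1]
  have hsl0 : 0 < √l := Real.sqrt_pos.2 hl0
  have hll : √l * √l = l := Real.mul_self_sqrt hl0.le
  have hsκ : 0 < √κ := Real.sqrt_pos.2 hκ0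
  have hsκ1 : √κ ≤ 1 := Real.sqrt_le_one.2 (by linarith)
  have hsh : 0 < √(h : ℝ) := Real.sqrt_pos.2 (by linarith)
  have hA : (16 * (W : ℝ) ^ 2 * l * L + 2) * (4 / √l) ≤ 64 * W ^ 2 * Y * √l + 8 / √l := by
    have e : (16 * (W : ℝ) ^ 2 * l * L + 2) * (4 / √l) = 64 * W ^ 2 * L * √l + 8 / √l := by
      linear_combination (64 * (W : ℝ) ^ 2 * L) * Real.div_sqrt (x := l)
    rw [e]
    gcongr
  have e1 : (Y : ℝ) * (Y : ℝ) ^ (γ / 2 - 1) = (Y : ℝ) ^ (γ / 2) := by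
    nth_rewrite 1 [← Real.rpow_one (Y : ℝ)]
    rw [← Real.rpow_add hY0]; congr 1; ring
  have e2 : (Y : ℝ) ^ (1 - γ / 2) = ((Y : ℝ) ^ (γ / 2 - 1))⁻¹ := by
    rw [← Real.rpow_neg hY0.le]; congr 1; ring
  have hp1 : 64 * (W : ℝ) ^ 2 * Y * √l ≤ 32 / √κ * W ^ 2 * (√h * (Y : ℝ) ^ (γ / 2)) := by
    have e3 : 64 * (W : ℝ) ^ 2 * Y * √l = 16 * √κ * (W ^ 2 * (√h * (Y : ℝ) ^ (γ / 2))) := by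
      rw [hsl, ← e1]; ring
    have e4 : 16 * √κ ≤ 32 / √κ := by
      rw [le_div_iff₀ hsκ]; nlinarith
    rw [e3, mul_assoc (32 / √κ)]
    exact mul_le_mul_of_nonneg_right e4 (by positivity)
  have hp2 : 8 / √l ≤ 32 / √κ * W ^ 2 * ((Y : ℝ) ^ (1 - γ / 2) / √h) := by
    have e3 : 8 / √l = 32 / √κ * 1 * ((Y : ℝ) ^ (1 - γ / 2) / √h) := by
      rw [hsl, e2]; field_simp; norm_num
    rw [e3]
    have : (1 : ℝ) ≤ W ^ 2 := one_le_pow₀ hW'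
    gcongr
  rw [mul_add]
  linarith

/-- Complex conjugation flips the sign of the phase and replaces x by -x; the bound is uniform in x.
-/
lemma norm_sum_ex_rpow_le {γ : ℝ} (h0 : 0 < γ) (h1 : γ < 1) (W b Y : ℕ) (hW : 1 ≤ W)
    (hY : 1 ≤ Y) (t : Finset ℤ) (ht : ∀ a ∈ t, ∀ c ∈ t, ∀ b, a ≤ b → b ≤ c → b ∈ t)
    (htY : ∀ n ∈ t, (Y : ℤ) ≤ W * n - b ∧ (W : ℤ) * n - b < 2 * Y) (h : ℕ) (hh : 1 ≤ h)
    (hhY : (h : ℝ) ≤ (Y : ℝ) ^ (1 - γ)) (x : ℝ) :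
    ‖∑ n ∈ t, ex (h * (((W : ℤ) * n - b : ℤ) : ℝ) ^ γ + n * x)‖ ≤
      32 / √(γ * (1 - γ)) * (W : ℝ) ^ 2 *
        (√h * (Y : ℝ) ^ (γ / 2) + (Y : ℝ) ^ (1 - γ / 2) / √h) := by
  rw [← RCLike.norm_conj, map_sum]
  refine le_trans (le_of_eq ?_) (norm_sum_ex_neg_rpow_le h0 h1 W b Y hW hY t ht htY h hh hhY (-x))
  congr 1
  refine Finset.sum_congr rfl fun n _ => ?_
  rw [conj_ex]; congr 1; ring

/-! ### The Fejér kernel and its oscillating part. -/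

/-- The Fejér kernel `H⁻¹ |∑_{h < H} e(h x)|²`. -/
noncomputable def fejer (H : ℕ) (x : ℝ) : ℝ := ‖∑ h ∈ Finset.range H, ex (h * x)‖ ^ 2 / H

lemma fejer_nonneg (H : ℕ) (x : ℝ) : 0 ≤ fejer H x := by unfold fejer; positivity

/-- Expanding the square, the H diagonal terms contribute exactly 1 after division by H. -/
lemma fejer_sub_one {H : ℕ} (hH : 0 < H) (x : ℝ) :
    ((fejer H x - 1 : ℝ) : ℂ) = 1 / H * ∑ h ∈ Finset.range H,
      ∑ j ∈ (Finset.range H).erase h, ex (((h : ℝ) - j) * x) := by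
  have hH' : (H : ℂ) ≠ 0 := by exact_mod_cast hH.ne'
  have h1 : ((‖∑ h ∈ Finset.range H, ex (h * x)‖ ^ 2 : ℝ) : ℂ) =
      ∑ h ∈ Finset.range H, (1 + ∑ j ∈ (Finset.range H).erase h, ex (((h : ℝ) - j) * x)) := by
    rw [Complex.ofReal_pow, ← Complex.mul_conj', map_sum, Finset.sum_mul_sum]
    refine Finset.sum_congr rfl fun h hh => ?_
    have e : ∀ j : ℕ, ex (h * x) * (starRingEnd ℂ) (ex (j * x)) = ex (((h : ℝ) - j) * x) :=
      fun j => by rw [conj_ex, ← ex_add]; congr 1; ring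
    simp_rw [e]
    rw [← Finset.add_sum_erase _ _ hh, sub_self, zero_mul, ex_zero]
  rw [fejer, Complex.ofReal_sub, Complex.ofReal_div, h1, Finset.sum_add_distrib]
  simp only [Finset.sum_const, Finset.card_range, nsmul_eq_mul, mul_one, Complex.ofReal_natCast,
    Complex.ofReal_one]
  generalize ∑ h ∈ Finset.range H, ∑ j ∈ (Finset.range H).erase h, ex (((h : ℝ) - j) * x) = T
  field_simp
  ring

/-- All the phases h(x - k) are at most 1/6 in absolute value, so every summand has real part at
least cos(π/3) = 1/2 and there is no cancellation. -/
lemma le_fejer {H : ℕ} (hH : 0 < H) (x : ℝ) (k : ℤ) (hx : |x - k| * ((H : ℝ) - 1) ≤ 1 / 6) :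
    (H : ℝ) / 4 ≤ fejer H x := by
  have hH' : (0 : ℝ) < H := by exact_mod_cast hH
  have hre : (H : ℝ) / 2 ≤ (∑ h ∈ Finset.range H, ex (h * x)).re := by
    rw [Complex.re_sum]
    have : ∀ h ∈ Finset.range H, (1 / 2 : ℝ) ≤ (ex (h * x)).re := fun h hh => by
      have hh' : (h : ℝ) ≤ H - 1 := by
        have := Finset.mem_range.1 hh
        have : (h : ℝ) + 1 ≤ H := by exact_mod_cast this
        linarith
      have e : ex (h * x) = ex (h * (x - k)) := by
        have := ex_sub_int (h * x) (h * k)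
        rw [← this]; congr 1; push_cast; ring
      have e2 : (ex (h * (x - k))).re = Real.cos (2 * Real.pi * (h * (x - k))) := by
        rw [ex, ← Complex.exp_ofReal_mul_I_re]; congr 2; push_cast; ring
      rw [e, e2, ← Real.cos_pi_div_three, ← Real.cos_abs (2 * Real.pi * (h * (x - k)))]
      have hpi := Real.pi_pos
      have h3 : |2 * Real.pi * (h * (x - k))| ≤ Real.pi / 3 := by
        rw [abs_mul (2 * Real.pi), abs_mul (h : ℝ), abs_of_pos (by positivity : 0 < 2 * Real.pi), Nat.abs_cast]
        have : (h : ℝ) * |x - k| ≤ 1 / 6 := by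
          refine le_trans ?_ hx
          rw [mul_comm]
          exact mul_le_mul_of_nonneg_left hh' (abs_nonneg _)
        nlinarith
      exact Real.cos_le_cos_of_nonneg_of_le_pi (abs_nonneg _) (by linarith) h3
    have h2 := Finset.card_nsmul_le_sum _ _ _ this
    rw [Finset.card_range, nsmul_eq_mul] at h2
    linarith
  have h3 : (H : ℝ) / 2 ≤ ‖∑ h ∈ Finset.range H, ex (h * x)‖ := hre.trans (Complex.re_le_norm _)
  have h4 := pow_le_pow_left₀ (by positivity) h3 2
  rw [fejer, le_div_iff₀ hH']
  nlinarith

lemma sum_one_div_sqrt_le (n : ℕ) : ∑ h ∈ Finset.Icc 1 n, 1 / √(h : ℝ) ≤ 2 * √n := by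
  induction n with
  | zero => simp
  | succ n ih =>
    rw [Finset.sum_Icc_succ_top (by omega)]
    have h0 : (0 : ℝ) ≤ n := Nat.cast_nonneg n
    have h1 : 0 < √((n + 1 : ℕ) : ℝ) := Real.sqrt_pos.2 (by positivity)
    have h2 : √((n + 1 : ℕ) : ℝ) * √((n + 1 : ℕ) : ℝ) = n + 1 := by
      rw [Real.mul_self_sqrt (by positivity)]; push_cast; ring
    have h3 : √(n : ℝ) * √(n : ℝ) = n := Real.mul_self_sqrt h0
    have h4 : 1 / √((n + 1 : ℕ) : ℝ) ≤ 2 * √((n + 1 : ℕ) : ℝ) - 2 * √(n : ℝ) := by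
      rw [div_le_iff₀ h1]
      nlinarith [sq_nonneg (√((n + 1 : ℕ) : ℝ) - √(n : ℝ))]
    linarith

/-- The truncated difference of maximum and minimum is |h - j|. Each nonzero distance occurs at most
once on either side of h, whence the factor 2. -/
lemma sum_erase_range_le (H h : ℕ) (hh : h < H) (B : ℕ → ℝ) (hB : ∀ i, 0 ≤ B i) (S : ℕ → ℝ)
    (hS : ∀ j < H, j ≠ h → S j ≤ B (max h j - min h j)) :
    ∑ j ∈ (Finset.range H).erase h, S j ≤ 2 * ∑ i ∈ Finset.Icc 1 (H - 1), B i := by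
  have hsplit : (Finset.range H).erase h = Finset.range h ∪ Finset.Ico (h + 1) H := by
    ext j
    simp only [Finset.mem_erase, Finset.mem_range, Finset.mem_union, Finset.mem_Ico]
    omega
  have hdisj : Disjoint (Finset.range h) (Finset.Ico (h + 1) H) := by
    rw [Finset.disjoint_left]
    intro j hj hj'
    rw [Finset.mem_range] at hj
    rw [Finset.mem_Ico] at hj'
    omega
  have key : ∀ (s : Finset ℕ), s ⊆ (Finset.range H).erase h →
      Set.InjOn (fun j => max h j - min h j) s →
      ∑ j ∈ s, S j ≤ ∑ i ∈ Finset.Icc 1 (H - 1), B i := by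
    intro s hs hinj
    calc ∑ j ∈ s, S j ≤ ∑ j ∈ s, B (max h j - min h j) := Finset.sum_le_sum fun j hj => by
          have := Finset.mem_erase.1 (hs hj)
          exact hS j (Finset.mem_range.1 this.2) this.1
      _ = ∑ i ∈ s.image (fun j => max h j - min h j), B i := (Finset.sum_image hinj).symm
      _ ≤ _ := by
          refine Finset.sum_le_sum_of_subset_of_nonneg (fun i hi => ?_) fun i _ _ => hB i
          obtain ⟨j, hj, rfl⟩ := Finset.mem_image.1 hi
          have := Finset.mem_erase.1 (hs hj)
          rw [Finset.mem_range] at this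
          rw [Finset.mem_Icc]
          omega
  have k1 := key (Finset.range h) (hsplit ▸ Finset.subset_union_left) (by
    intro a ha b hb hab
    simp only [Finset.coe_range, Set.mem_Iio] at ha hb
    simp only at hab
    omega)
  have k2 := key (Finset.Ico (h + 1) H) (hsplit ▸ Finset.subset_union_right) (by
    intro a ha b hb hab
    simp only [Finset.coe_Ico, Set.mem_Ico] at ha hb
    simp only at hab
    omega)
  rw [hsplit, Finset.sum_union hdisj]
  linarith

/-- The oscillating part of the Fejér majorant on a dyadic piece. -/
lemma norm_sum_fejer_sub_one_le {γ : ℝ} (h0 : 0 < γ) (h1 : γ < 1) (W b Y H : ℕ) (hW : 1 ≤ W)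
    (hY : 1 ≤ Y) (t : Finset ℤ) (ht : ∀ a ∈ t, ∀ c ∈ t, ∀ b, a ≤ b → b ≤ c → b ∈ t)
    (htY : ∀ n ∈ t, (Y : ℤ) ≤ W * n - b ∧ (W : ℤ) * n - b < 2 * Y) (hH : 0 < H)
    (hHY : (H : ℝ) - 1 ≤ (Y : ℝ) ^ (1 - γ)) (x : ℝ) :
    ‖∑ n ∈ t, ((fejer H ((((W : ℤ) * n - b : ℤ) : ℝ) ^ γ) - 1 : ℝ) : ℂ) * ex (n * x)‖ ≤
      192 / √(γ * (1 - γ)) * (W : ℝ) ^ 2 * (Y : ℝ) ^ (3 / 2 - γ) := by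
  have hY' : (1 : ℝ) ≤ Y := by exact_mod_cast hY
  have hY0 : (0 : ℝ) < Y := by linarith
  have hH' : (0 : ℝ) < H := by exact_mod_cast hH
  set A := 32 / √(γ * (1 - γ)) * (W : ℝ) ^ 2 with hA
  have hA0 : 0 ≤ A := by positivity
  set B : ℕ → ℝ := fun h => A * (√h * (Y : ℝ) ^ (γ / 2) + (Y : ℝ) ^ (1 - γ / 2) / √h) with hB
  have hB0 : ∀ i, 0 ≤ B i := fun i => by simp only [hB]; positivity
  set S : ℕ → ℕ → ℂ := fun h j =>
    ∑ n ∈ t, ex (((h : ℝ) - j) * (((W : ℤ) * n - b : ℤ) : ℝ) ^ γ + n * x) with hS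
  have hexp : ∑ n ∈ t, ((fejer H ((((W : ℤ) * n - b : ℤ) : ℝ) ^ γ) - 1 : ℝ) : ℂ) * ex (n * x) =
      1 / H * ∑ h ∈ Finset.range H, ∑ j ∈ (Finset.range H).erase h, S h j := by
    simp_rw [fejer_sub_one hH, mul_assoc, Finset.sum_mul, ← Finset.mul_sum]
    congr 1
    rw [Finset.sum_comm]
    refine Finset.sum_congr rfl fun h _ => ?_
    rw [Finset.sum_comm]
    refine Finset.sum_congr rfl fun j _ => ?_
    simp only [hS]
    refine Finset.sum_congr rfl fun n _ => ?_
    rw [ex_add]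
  have hSB : ∀ h < H, ∀ j < H, j ≠ h → ‖S h j‖ ≤ B (max h j - min h j) := by
    intro h hh j hj hjh
    have hle : ∀ d : ℕ, d < H → (d : ℝ) ≤ (Y : ℝ) ^ (1 - γ) := fun d hd => by
      have : (d : ℝ) + 1 ≤ H := by exact_mod_cast hd
      linarith
    rcases lt_or_gt_of_ne hjh with hlt | hlt
    · have e : max h j - min h j = h - j := by omega
      have e2 : (h : ℝ) - j = ((h - j : ℕ) : ℝ) := by push_cast [hlt.le]; ring
      rw [e]
      simp only [hS, e2]
      exact norm_sum_ex_rpow_le h0 h1 W b Y hW hY t ht htY (h - j) (by omega)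
        (hle _ (by omega)) x
    · have e : max h j - min h j = j - h := by omega
      have e2 : (h : ℝ) - j = -((j - h : ℕ) : ℝ) := by push_cast [hlt.le]; ring
      rw [e]
      simp only [hS, e2, neg_mul]
      simp only [← mul_neg]
      exact norm_sum_ex_neg_rpow_le h0 h1 W b Y hW hY t ht htY (j - h) (by omega)
        (hle _ (by omega)) x
  have hrow : ∀ h ∈ Finset.range H, ‖∑ j ∈ (Finset.range H).erase h, S h j‖ ≤
      2 * ∑ i ∈ Finset.Icc 1 (H - 1), B i := fun h hh => by
    refine (norm_sum_le _ _).trans ?_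
    exact sum_erase_range_le H h (Finset.mem_range.1 hh) B hB0 _
      fun j hj hjh => hSB h (Finset.mem_range.1 hh) j hj hjh
  -- With H - 1 ≤ Y^(1-γ) both parts of `B` sum to the order Y^(3/2-γ): the √h terms give 1 and the
  -- 1/√h terms give 2 times this.
  have hBsum : ∑ i ∈ Finset.Icc 1 (H - 1), B i ≤ A * (3 * (Y : ℝ) ^ (3 / 2 - γ)) := by
    simp only [hB]
    rw [← Finset.mul_sum]
    refine mul_le_mul_of_nonneg_left ?_ hA0
    rw [Finset.sum_add_distrib]
    have hn : ((H - 1 : ℕ) : ℝ) ≤ (Y : ℝ) ^ (1 - γ) := by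
      rw [Nat.cast_sub hH]; simpa using hHY
    have hsq : √((H - 1 : ℕ) : ℝ) ≤ (Y : ℝ) ^ ((1 - γ) / 2) := by
      refine (Real.sqrt_le_sqrt hn).trans (le_of_eq ?_)
      rw [Real.sqrt_eq_rpow, ← Real.rpow_mul hY0.le]; congr 1; ring
    have s1 : ∑ i ∈ Finset.Icc 1 (H - 1), √(i : ℝ) * (Y : ℝ) ^ (γ / 2) ≤
        (Y : ℝ) ^ (3 / 2 - γ) := by
      have : ∀ i ∈ Finset.Icc 1 (H - 1), √(i : ℝ) * (Y : ℝ) ^ (γ / 2) ≤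
          (Y : ℝ) ^ ((1 - γ) / 2) * (Y : ℝ) ^ (γ / 2) := fun i hi => by
        refine mul_le_mul_of_nonneg_right (le_trans (Real.sqrt_le_sqrt ?_) hsq) (by positivity)
        exact_mod_cast (Finset.mem_Icc.1 hi).2
      refine (Finset.sum_le_card_nsmul _ _ _ this).trans ?_
      rw [nsmul_eq_mul, Nat.card_Icc, Nat.add_sub_cancel]
      refine (mul_le_mul_of_nonneg_right hn (by positivity)).trans (le_of_eq ?_)
      rw [← Real.rpow_add hY0, ← Real.rpow_add hY0]; congr 1; ring
    have s2 : ∑ i ∈ Finset.Icc 1 (H - 1), (Y : ℝ) ^ (1 - γ / 2) / √(i : ℝ) ≤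
        2 * (Y : ℝ) ^ (3 / 2 - γ) := by
      have e : ∀ i : ℕ, (Y : ℝ) ^ (1 - γ / 2) / √(i : ℝ) =
          (Y : ℝ) ^ (1 - γ / 2) * (1 / √(i : ℝ)) := fun i => by ring
      simp_rw [e]
      rw [← Finset.mul_sum]
      have a1 := (sum_one_div_sqrt_le (H - 1)).trans (mul_le_mul_of_nonneg_left hsq zero_le_two)
      refine (mul_le_mul_of_nonneg_left a1 (by positivity)).trans (le_of_eq ?_)
      rw [mul_left_comm, ← Real.rpow_add hY0]; congr 2; ring
    linarith
  rw [hexp, norm_mul]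
  have hn : ‖(1 / H : ℂ)‖ = 1 / H := by simp
  rw [hn]
  have hall := (norm_sum_le _ _).trans (Finset.sum_le_card_nsmul _ _ _ hrow)
  rw [Finset.card_range, nsmul_eq_mul] at hall
  calc 1 / (H : ℝ) * ‖∑ h ∈ Finset.range H, ∑ j ∈ (Finset.range H).erase h, S h j‖
      ≤ 1 / (H : ℝ) * (H * (2 * ∑ i ∈ Finset.Icc 1 (H - 1), B i)) :=
        mul_le_mul_of_nonneg_left hall (by positivity)
    _ = 2 * ∑ i ∈ Finset.Icc 1 (H - 1), B i := by field_simp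
    _ ≤ 2 * (A * (3 * (Y : ℝ) ^ (3 / 2 - γ))) := by linarith
    _ = _ := by rw [hA]; ring

/-! ### The Dirichlet kernel and its moments. -/

/-- A majorant of the Dirichlet kernel of length `P`. -/
noncomputable def dirichletMajorant (P x : ℝ) : ℝ := 2 * P / (1 + P * |Real.sin (Real.pi * x)|)

/-- The trivial bound P and the geometric series bound 1/|sin πx| combine into one continuous
periodic majorant. -/
lemma norm_sum_ex_le_dirichletMajorant (s : Finset ℤ)
    (hs : ∀ a ∈ s, ∀ c ∈ s, ∀ b, a ≤ b → b ≤ c → b ∈ s) (P : ℝ) (hP : (s.card : ℝ) ≤ P)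
    (x : ℝ) : ‖∑ n ∈ s, ex (n * x)‖ ≤ dirichletMajorant P x := by
  have hP0 : 0 ≤ P := (Nat.cast_nonneg _).trans hP
  have h1 : ‖∑ n ∈ s, ex (n * x)‖ ≤ P := by
    refine (norm_sum_le _ _).trans ?_
    simpa [norm_ex] using hP
  have h2 : ‖∑ n ∈ s, ex (n * x)‖ * |Real.sin (Real.pi * x)| ≤ 1 := by
    obtain ⟨n₀, L, -, -, hsum⟩ := sum_eq_sum_range_of_ordConnected s hs
    rw [hsum]
    have e : (∑ i ∈ Finset.range L, ex (((n₀ + i : ℤ) : ℝ) * x)) * (1 - ex x) =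
        ex (n₀ * x) - ex ((n₀ + L) * x) := by
      clear hsum
      induction L with
      | zero => simp
      | succ L ih =>
        rw [Finset.sum_range_succ, add_mul, ih]
        have e1 : ((n₀ : ℝ) + (L + 1 : ℕ)) * x = ((n₀ : ℝ) + L) * x + x := by push_cast; ring
        have e2 : (((n₀ + L : ℤ) : ℝ) * x) = ((n₀ : ℝ) + L) * x := by push_cast; ring
        rw [e1, e2, ex_add _ x]; ring
    have e' := congrArg norm e
    rw [norm_mul, norm_one_sub_ex] at e'
    have := norm_sub_le (ex (n₀ * x)) (ex ((n₀ + L) * x))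
    rw [norm_ex, norm_ex] at this
    linarith
  rw [dirichletMajorant, le_div_iff₀ (by positivity)]
  nlinarith

lemma continuous_dirichletMajorant {P : ℝ} (hP : 0 ≤ P) : Continuous (dirichletMajorant P) := by
  unfold dirichletMajorant
  refine Continuous.div continuous_const (by fun_prop) fun x => ?_
  positivity

lemma dirichletMajorant_nonneg {P : ℝ} (hP : 0 ≤ P) (x : ℝ) : 0 ≤ dirichletMajorant P x := by
  unfold dirichletMajorant; positivity

lemma periodic_dirichletMajorant (P : ℝ) : Function.Periodic (dirichletMajorant P) 1 := by
  intro x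
  rw [dirichletMajorant, mul_add, mul_one, Real.sin_add_pi, abs_neg]
  rfl

lemma integral_one_add_mul_rpow_le {P β : ℝ} (hP : 0 < P) (hβ : 1 < β) :
    ∫ x in (0 : ℝ)..1, (1 + 2 * P * x) ^ (-β) ≤ 1 / (2 * P * (β - 1)) := by
  have hβ' : 0 < β - 1 := by linarith
  rw [intervalIntegral.integral_comp_add_mul (fun y => y ^ (-β)) (by positivity : 2 * P ≠ 0) 1,
    integral_rpow (Or.inr ⟨by linarith, ?_⟩)]
  · simp only [mul_zero, add_zero, mul_one, Real.one_rpow, smul_eq_mul]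
    have : (0 : ℝ) ≤ (1 + 2 * P) ^ (-β + 1) := by positivity
    have e : (2 * P)⁻¹ * (((1 + 2 * P) ^ (-β + 1) - 1) / (-β + 1)) =
        (1 - (1 + 2 * P) ^ (-β + 1)) * (1 / (2 * P * (β - 1))) := by
      have : -β + 1 ≠ 0 := by linarith
      have : β - 1 ≠ 0 := by linarith
      field_simp
      ring
    rw [e]
    have h2 : 0 < 1 / (2 * P * (β - 1)) := by positivity
    nlinarith
  · rw [Set.uIcc_of_le (by linarith)]
    simp only [Set.mem_Icc, not_and_or, not_le]
    left; norm_num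

/-- By Jordan's inequality |sin πx| is at least 2x or 2(1 - x), according to the half of [0, 1]. The
remaining integral converges uniformly in P because β > 1. -/
lemma integral_dirichletMajorant_rpow_le {P β : ℝ} (hP : 0 < P) (hβ : 1 < β) :
    ∫ x in (0 : ℝ)..1, dirichletMajorant P x ^ β ≤ 2 ^ β / (β - 1) * P ^ (β - 1) := by
  have hβ' : 0 < β - 1 := by linarith
  have hcont : ∀ h : ℝ → ℝ, Continuous h → (∀ x ∈ Set.Icc (0 : ℝ) 1, 0 ≤ h x) →
      ContinuousOn (fun x => (1 + 2 * P * h x) ^ (-β)) (Set.uIcc 0 1) := fun h hh h0 => by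
    refine ContinuousOn.rpow_const (by fun_prop) fun x hx => Or.inl ?_
    rw [Set.uIcc_of_le zero_le_one] at hx
    have := h0 x hx
    positivity
  have i1 : IntervalIntegrable (fun x => (1 + 2 * P * x) ^ (-β)) MeasureTheory.volume 0 1 :=
    (hcont (fun x => x) continuous_id fun x hx => hx.1).intervalIntegrable
  have i2 : IntervalIntegrable (fun x => (1 + 2 * P * (1 - x)) ^ (-β))
      MeasureTheory.volume 0 1 :=
    (hcont (fun x => 1 - x) (by fun_prop) fun x hx => by linarith [hx.2]).intervalIntegrable
  have hpt : ∀ x ∈ Set.Icc (0 : ℝ) 1, dirichletMajorant P x ^ β ≤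
      (2 * P) ^ β * ((1 + 2 * P * x) ^ (-β) + (1 + 2 * P * (1 - x)) ^ (-β)) := by
    intro x hx
    have hx0 : 0 ≤ 1 - x := by linarith [hx.2]
    have hx1 := hx.1
    rw [dirichletMajorant, Real.div_rpow (by positivity) (by positivity), div_eq_mul_inv,
      ← Real.rpow_neg (by positivity)]
    refine mul_le_mul_of_nonneg_left ?_ (by positivity)
    have hpi := Real.pi_pos
    have p1 : 0 ≤ (1 + 2 * P * x) ^ (-β) := by positivity
    have p2 : 0 ≤ (1 + 2 * P * (1 - x)) ^ (-β) := by positivity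
    rcases le_total x (1 / 2) with h | h
    · have := Real.mul_le_sin (x := Real.pi * x) (by nlinarith) (by nlinarith)
      have e : 2 / Real.pi * (Real.pi * x) = 2 * x := by field_simp
      rw [e] at this
      have a : 2 * x ≤ |Real.sin (Real.pi * x)| := this.trans (le_abs_self _)
      have : (1 + P * |Real.sin (Real.pi * x)|) ^ (-β) ≤ (1 + 2 * P * x) ^ (-β) :=
        Real.rpow_le_rpow_of_nonpos (by positivity) (by nlinarith) (by linarith)
      linarith
    · have := Real.mul_le_sin (x := Real.pi * (1 - x)) (by nlinarith) (by nlinarith)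
      have e : 2 / Real.pi * (Real.pi * (1 - x)) = 2 * (1 - x) := by field_simp
      have e2 : Real.sin (Real.pi * (1 - x)) = Real.sin (Real.pi * x) := by
        rw [mul_sub, mul_one, Real.sin_pi_sub]
      rw [e, e2] at this
      have a : 2 * (1 - x) ≤ |Real.sin (Real.pi * x)| := this.trans (le_abs_self _)
      have : (1 + P * |Real.sin (Real.pi * x)|) ^ (-β) ≤ (1 + 2 * P * (1 - x)) ^ (-β) :=
        Real.rpow_le_rpow_of_nonpos (by positivity) (by nlinarith) (by linarith)
      linarith
  refine (intervalIntegral.integral_mono_on zero_le_one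
    (((continuous_dirichletMajorant hP.le).rpow_const
      fun x => Or.inr (by linarith)).intervalIntegrable _ _)
    ((i1.add i2).const_mul _) hpt).trans ?_
  rw [intervalIntegral.integral_const_mul, intervalIntegral.integral_add i1 i2,
    intervalIntegral.integral_comp_sub_left (fun y => (1 + 2 * P * y) ^ (-β)) 1, sub_self,
    sub_zero]
  have h := integral_one_add_mul_rpow_le hP hβ
  have h2 : (2 * P) ^ β * ((∫ x in (0 : ℝ)..1, (1 + 2 * P * x) ^ (-β)) +
      ∫ x in (0 : ℝ)..1, (1 + 2 * P * x) ^ (-β)) ≤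
      (2 * P) ^ β * (1 / (2 * P * (β - 1)) + 1 / (2 * P * (β - 1))) :=
    mul_le_mul_of_nonneg_left (add_le_add h h) (by positivity)
  refine h2.trans (le_of_eq ?_)
  rw [Real.mul_rpow zero_le_two hP.le, Real.rpow_sub_one hP.ne']
  field_simp
  norm_num

/-! ### The pseudorandom majorant. -/

/-- The length of the Fejér kernel used at an integer `m`. It depends only on the dyadic size
of `m`. -/
noncomputable def dyadicHeight (γ : ℝ) (j : ℕ) : ℕ :=
  ⌊((2 ^ j : ℕ) : ℝ) ^ (1 - γ) / 6⌋₊ + 1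

/-- The Fejér majorant of the weighted indicator function of `ℕ^c` along `W n - b`. -/
noncomputable def fejerMajorant (γ : ℝ) (W b : ℕ) (n : ℤ) : ℝ :=
  96 * fejer (dyadicHeight γ (Nat.log 2 ((W : ℤ) * n - b).toNat)) ((((W : ℤ) * n - b : ℤ) : ℝ) ^ γ)

/-- Keeps the frequencies short enough for `le_fejer`, which dictates the 6, and for the exponential
sum bounds. The companion lower bound makes the kernel tall enough to dominate the weight. -/
lemma dyadicHeight_sub_one_le (γ : ℝ) (j : ℕ) :
    (dyadicHeight γ j : ℝ) - 1 ≤ ((2 ^ j : ℕ) : ℝ) ^ (1 - γ) / 6 := by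
  rw [dyadicHeight]
  push_cast
  rw [add_sub_cancel_right]
  exact Nat.floor_le (by positivity)

lemma le_dyadicHeight (γ : ℝ) (j : ℕ) :
    ((2 ^ j : ℕ) : ℝ) ^ (1 - γ) / 6 ≤ dyadicHeight γ j := by
  rw [dyadicHeight]
  push_cast
  exact (Nat.lt_floor_add_one _).le

lemma pow_log_toNat_le {m : ℤ} (hm : 1 ≤ m) :
    ((2 ^ Nat.log 2 m.toNat : ℕ) : ℤ) ≤ m ∧ m < 2 * ((2 ^ Nat.log 2 m.toNat : ℕ) : ℤ) := by
  have h1 := Nat.pow_log_le_self 2 (x := m.toNat) (by omega)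
  have h2 := Nat.lt_pow_succ_log_self (b := 2) (by norm_num) m.toNat
  rw [pow_succ] at h2
  omega

/-- On a dyadic level of m = W n - b the height is constant and the n form an interval, so
`norm_sum_fejer_sub_one_le` applies. Since 3/2 - γ > 0 the level bounds grow geometrically and the
top level dominates. -/
lemma norm_trigSum_fejerMajorant_le {γ : ℝ} (h0 : 0 < γ) (h1 : γ < 1) (W b : ℕ) (hW : 1 ≤ W)
    (X : ℝ) (hX : 1 ≤ X) (s : Finset ℤ) (hs : ∀ a ∈ s, ∀ c ∈ s, ∀ b, a ≤ b → b ≤ c → b ∈ s)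
    (hsX : ∀ n ∈ s, 1 ≤ (W : ℤ) * n - b ∧ (((W : ℤ) * n - b : ℤ) : ℝ) ≤ X) (P : ℝ)
    (hP : (s.card : ℝ) ≤ P) (x : ℝ) :
    ‖trigSum s (fun n => (fejerMajorant γ W b n : ℂ)) x‖ ≤ 96 * dirichletMajorant P x +
      96 * (192 / √(γ * (1 - γ)) * (2 ^ (3 / 2 - γ) / (2 ^ (3 / 2 - γ) - 1))) * W ^ 2 *
        X ^ (3 / 2 - γ) := by
  set A := 192 / √(γ * (1 - γ)) with hA
  have hA0 : 0 ≤ A := by positivity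
  set a := 3 / 2 - γ with ha
  have ha0 : 0 < a := by linarith
  set q : ℝ := 2 ^ a with hq
  have hq1 : 1 < q := Real.one_lt_rpow (by norm_num) ha0
  set lg : ℤ → ℕ := fun n => Nat.log 2 ((W : ℤ) * n - b).toNat with hlg
  set G : ℤ → ℂ := fun n => ((fejer (dyadicHeight γ (lg n))
    ((((W : ℤ) * n - b : ℤ) : ℝ) ^ γ) - 1 : ℝ) : ℂ) * ex (n * x) with hG
  have hsplit : trigSum s (fun n => (fejerMajorant γ W b n : ℂ)) x =
      96 * (∑ n ∈ s, ex (n * x) + ∑ n ∈ s, G n) := by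
    rw [trigSum, ← Finset.sum_add_distrib, Finset.mul_sum]
    refine Finset.sum_congr rfl fun n _ => ?_
    simp only [hG, hlg, fejerMajorant]
    push_cast
    ring
  set J := Nat.log 2 ⌊X⌋₊ with hJ
  have hX0 : 0 ≤ X := by linarith
  have hmono : Monotone lg := fun n n' h => by
    simp only [hlg]
    refine Nat.log_mono_right (Int.toNat_le_toNat ?_)
    have : (W : ℤ) * n ≤ W * n' := mul_le_mul_of_nonneg_left h (by positivity)
    linarith
  have hmaps : ∀ n ∈ s, lg n ∈ Finset.range (J + 1) := fun n hn => by
    rw [Finset.mem_range, Nat.lt_succ_iff]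
    refine Nat.log_mono_right (Nat.le_floor ?_)
    have := hsX n hn
    have e : (((((W : ℤ) * n - b).toNat : ℕ) : ℤ) : ℝ) = (((W : ℤ) * n - b : ℤ) : ℝ) := by
      rw [Int.toNat_of_nonneg (by omega)]
    rw [Int.cast_natCast] at e
    rw [e]
    exact this.2
  have hpiece : ∀ j ∈ Finset.range (J + 1), ‖∑ n ∈ s.filter (fun n => lg n = j), G n‖ ≤
      A * W ^ 2 * q ^ j := by
    intro j _
    have e : ∑ n ∈ s.filter (fun n => lg n = j), G n = ∑ n ∈ s.filter (fun n => lg n = j),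
        ((fejer (dyadicHeight γ j) ((((W : ℤ) * n - b : ℤ) : ℝ) ^ γ) - 1 : ℝ) : ℂ) *
          ex (n * x) := Finset.sum_congr rfl fun n hn => by
      simp only [hG, (Finset.mem_filter.1 hn).2]
    rw [e]
    have hY : 1 ≤ 2 ^ j := Nat.one_le_two_pow
    refine (norm_sum_fejer_sub_one_le h0 h1 W b (2 ^ j) (dyadicHeight γ j) hW hY _ ?_ ?_
      (Nat.succ_pos _) ?_ x).trans (le_of_eq ?_)
    · intro n1 hn1 n3 hn3 n2 h12 h23
      rw [Finset.mem_filter] at hn1 hn3 ⊢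
      refine ⟨hs n1 hn1.1 n3 hn3.1 n2 h12 h23, le_antisymm ?_ ?_⟩
      · rw [← hn3.2]; exact hmono h23
      · rw [← hn1.2]; exact hmono h12
    · intro n hn
      rw [Finset.mem_filter] at hn
      have := pow_log_toNat_le (hsX n hn.1).1
      rw [← hn.2]
      exact this
    · have := dyadicHeight_sub_one_le γ j
      have h2 : (0 : ℝ) ≤ ((2 ^ j : ℕ) : ℝ) ^ (1 - γ) := by positivity
      linarith
    · rw [← hA, ← ha, hq]
      congr 1
      push_cast
      rw [← Real.rpow_natCast, ← Real.rpow_natCast, ← Real.rpow_mul zero_le_two,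
        ← Real.rpow_mul zero_le_two, mul_comm]
  have hGsum : ‖∑ n ∈ s, G n‖ ≤ A * W ^ 2 * (q / (q - 1) * X ^ a) := by
    rw [← Finset.sum_fiberwise_of_maps_to hmaps]
    refine (norm_sum_le _ _).trans ((Finset.sum_le_sum hpiece).trans ?_)
    rw [← Finset.mul_sum]
    refine mul_le_mul_of_nonneg_left ?_ (by positivity)
    have hgeom : ∑ j ∈ Finset.range (J + 1), q ^ j ≤ q ^ (J + 1) / (q - 1) := by
      rw [geom_sum_eq hq1.ne']
      exact div_le_div_of_nonneg_right (by linarith) (by linarith)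
    refine hgeom.trans ?_
    have hJX : q ^ J ≤ X ^ a := by
      have e : q ^ J = ((2 : ℝ) ^ J) ^ a := by
        rw [hq, ← Real.rpow_natCast, ← Real.rpow_natCast, ← Real.rpow_mul zero_le_two,
          ← Real.rpow_mul zero_le_two, mul_comm]
      rw [e]
      refine Real.rpow_le_rpow (by positivity) ?_ ha0.le
      have hf : ⌊X⌋₊ ≠ 0 := (Nat.floor_pos.2 hX).ne'
      have h3 := Nat.pow_log_le_self 2 hf
      have h4 : ((2 ^ J : ℕ) : ℝ) ≤ ⌊X⌋₊ := by exact_mod_cast h3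
      push_cast at h4
      exact h4.trans (Nat.floor_le hX0)
    rw [pow_succ, mul_comm (q ^ J), mul_div_right_comm]
    exact mul_le_mul_of_nonneg_left hJX (div_nonneg (by linarith) (by linarith))
  have hdir := norm_sum_ex_le_dirichletMajorant s hs P hP x
  rw [hsplit, norm_mul]
  have h96 : ‖(96 : ℂ)‖ = 96 := by simp
  rw [h96]
  have := norm_add_le (∑ n ∈ s, ex (n * x)) (∑ n ∈ s, G n)
  have e : 96 * (A * (q / (q - 1))) * (W : ℝ) ^ 2 * X ^ a =
      96 * (A * W ^ 2 * (q / (q - 1) * X ^ a)) := by ring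
  rw [e]
  linarith

/-- From m ≤ k^c < m + 1 and Bernoulli's inequality, m^γ is within Y^(γ-1) of k, where Y is the
dyadic size of m, so `le_fejer` applies. The constant is 96 = 2·2·6·4: c ≤ 2, m^(1-γ) ≤ 2 Y^(1-γ),
Y^(1-γ) ≤ 6H and H ≤ 4 times the kernel. -/
lemma mul_rpow_le_fejerMajorant {c : ℝ} (hc1 : 1 < c) (hc2 : c < 2) (W b : ℕ) (n : ℤ)
    (hm : 1 ≤ (W : ℤ) * n - b) (hps : (W : ℤ) * n - b ∈ psSet c) :
    c * (((W : ℤ) * n - b : ℤ) : ℝ) ^ (1 - 1 / c) ≤ fejerMajorant (1 / c) W b n := by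
  unfold fejerMajorant
  set m : ℤ := (W : ℤ) * n - b with hmdef
  obtain ⟨k, hk⟩ := hps
  have hc0 : 0 < c := by linarith
  set γ := 1 / c with hγ
  have hγ0 : 0 < γ := by positivity
  have hγ1 : γ < 1 := by rw [hγ, div_lt_one hc0]; exact hc1
  have hm1 : (1 : ℝ) ≤ m := by exact_mod_cast hm
  have hm0 : (0 : ℝ) < m := by linarith
  set j := Nat.log 2 m.toNat with hj
  obtain ⟨hY1, hY2⟩ := pow_log_toNat_le hm
  rw [← hj] at hY1 hY2
  set Y : ℝ := ((2 ^ j : ℕ) : ℝ) with hY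
  have hY1' : Y ≤ m := by
    have : (((2 ^ j : ℕ) : ℤ) : ℝ) ≤ m := by exact_mod_cast hY1
    rwa [Int.cast_natCast] at this
  have hY2' : (m : ℝ) ≤ 2 * Y := by
    have : (m : ℝ) ≤ ((2 * ((2 ^ j : ℕ) : ℤ) : ℤ) : ℝ) := Int.cast_le.2 hY2.le
    rwa [Int.cast_mul, Int.cast_natCast, Int.cast_ofNat] at this
  have hY0 : 0 < Y := by simp only [hY]; positivity
  have hkc := (Int.floor_eq_iff (z := m)).1 hk.symm
  have hkγ : ((k : ℝ) ^ c) ^ γ = k := by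
    rw [← Real.rpow_mul (Nat.cast_nonneg k), hγ, mul_one_div_cancel hc0.ne', Real.rpow_one]
  have hlow : (m : ℝ) ^ γ ≤ k := by
    rw [← hkγ]; exact Real.rpow_le_rpow hm0.le hkc.1 hγ0.le
  have hup : (k : ℝ) ≤ (m : ℝ) ^ γ + Y ^ (γ - 1) := by
    have a1 : (k : ℝ) ≤ ((m : ℝ) + 1) ^ γ := by
      rw [← hkγ]; exact Real.rpow_le_rpow (by positivity) hkc.2.le hγ0.le
    have a2 : ((m : ℝ) + 1) ^ γ = (m : ℝ) ^ γ * (1 + 1 / m) ^ γ := by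
      rw [← Real.mul_rpow hm0.le (by positivity)]; congr 1; field_simp
    have a3 : (1 + 1 / (m : ℝ)) ^ γ ≤ 1 + γ * (1 / m) :=
      rpow_one_add_le_one_add_mul_self (by
        have : 0 ≤ 1 / (m : ℝ) := by positivity
        linarith) hγ0.le hγ1.le
    have a4 : (m : ℝ) ^ γ * (1 / m) = (m : ℝ) ^ (γ - 1) := by
      rw [Real.rpow_sub_one hm0.ne']; ring
    have a5 : (m : ℝ) ^ (γ - 1) ≤ Y ^ (γ - 1) :=
      Real.rpow_le_rpow_of_nonpos hY0 hY1' (by linarith)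
    have a6 : 0 < (m : ℝ) ^ γ := by positivity
    have a7 : 0 < (m : ℝ) ^ (γ - 1) := by positivity
    calc (k : ℝ) ≤ (m : ℝ) ^ γ * (1 + 1 / m) ^ γ := a2 ▸ a1
      _ ≤ (m : ℝ) ^ γ * (1 + γ * (1 / m)) := mul_le_mul_of_nonneg_left a3 a6.le
      _ = (m : ℝ) ^ γ + γ * (m : ℝ) ^ (γ - 1) := by rw [← a4]; ring
      _ ≤ (m : ℝ) ^ γ + Y ^ (γ - 1) := by nlinarith
  have hdist : |(m : ℝ) ^ γ - (k : ℤ)| ≤ Y ^ (γ - 1) := by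
    rw [Int.cast_natCast, abs_le]
    have : 0 < Y ^ (γ - 1) := by positivity
    constructor <;> linarith
  have hH1 := dyadicHeight_sub_one_le γ j
  have hH2 := le_dyadicHeight γ j
  rw [← hY] at hH1 hH2
  have hfe := le_fejer (H := dyadicHeight γ j) (Nat.succ_pos _) ((m : ℝ) ^ γ) k (by
    have hnn : (0 : ℝ) ≤ (dyadicHeight γ j : ℝ) - 1 := by
      rw [sub_nonneg]
      exact_mod_cast Nat.succ_pos _
    calc |(m : ℝ) ^ γ - (k : ℤ)| * ((dyadicHeight γ j : ℝ) - 1) ≤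
          Y ^ (γ - 1) * (Y ^ (1 - γ) / 6) := mul_le_mul hdist hH1 hnn (by positivity)
      _ = 1 / 6 := by
          rw [← mul_div_assoc, ← Real.rpow_add hY0]
          simp)
  have hpow : (m : ℝ) ^ (1 - γ) ≤ 2 * Y ^ (1 - γ) := by
    calc (m : ℝ) ^ (1 - γ) ≤ (2 * Y) ^ (1 - γ) := Real.rpow_le_rpow hm0.le hY2' (by linarith)
      _ = 2 ^ (1 - γ) * Y ^ (1 - γ) := Real.mul_rpow zero_le_two hY0.le
      _ ≤ 2 ^ (1 : ℝ) * Y ^ (1 - γ) := by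
          refine mul_le_mul_of_nonneg_right ?_ (by positivity)
          exact Real.rpow_le_rpow_of_exponent_le one_le_two (by linarith)
      _ = _ := by rw [Real.rpow_one]
  have hpos : 0 < (m : ℝ) ^ (1 - γ) := by positivity
  nlinarith

/-! ### The size of W and the support of the weight. -/

/-- Already the crude w ≤ log log X suffices: W ≤ 4^w ≤ (log X)², which is smaller than any power of
X. -/
lemma trickW_le {ε : ℝ} (hε : 0 < ε) {X : ℝ} (hX : Real.exp (Real.exp 1) < X) :
    (trickW X : ℝ) ≤ (2 / ε) ^ 2 * X ^ ε := by
  have hX0 : 0 < X := (Real.exp_pos _).trans hX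
  have h1 : Real.exp 1 < Real.log X := (Real.lt_log_iff_exp_lt hX0).2 hX
  have hl0 : 0 < Real.log X := (Real.exp_pos _).trans h1
  have h2 : 1 < Real.log (Real.log X) := (Real.lt_log_iff_exp_lt hl0).2 h1
  have h3 : 0 < Real.log (Real.log (Real.log X)) := Real.log_pos h2
  have hw : Real.log (Real.log (Real.log (Real.log X))) ≤ Real.log (Real.log X) :=
    (Real.log_le_self h3.le).trans (Real.log_le_self (by linarith))
  have hfl : ((⌊Real.log (Real.log (Real.log (Real.log X)))⌋₊ : ℕ) : ℝ) ≤
      Real.log (Real.log X) := by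
    rcases le_total 0 (Real.log (Real.log (Real.log (Real.log X)))) with h | h
    · exact (Nat.floor_le h).trans hw
    · rw [Nat.floor_of_nonpos h]; push_cast; linarith
  have h4 : (4 : ℝ) ≤ Real.exp 2 := by
    have := Real.add_one_le_exp (1 : ℝ)
    have e : Real.exp 2 = Real.exp 1 * Real.exp 1 := by rw [← Real.exp_add]; norm_num
    rw [e]; nlinarith
  have hlog : Real.log X ≤ X ^ (ε / 2) / (ε / 2) :=
    Real.log_le_rpow_div hX0.le (by positivity)
  calc (trickW X : ℝ) ≤ (4 : ℝ) ^ ⌊Real.log (Real.log (Real.log (Real.log X)))⌋₊ := by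
        unfold trickW
        exact_mod_cast primorial_le_four_pow _
    _ ≤ Real.exp 2 ^ ⌊Real.log (Real.log (Real.log (Real.log X)))⌋₊ :=
        pow_le_pow_left₀ (by norm_num) h4 _
    _ = Real.exp (⌊Real.log (Real.log (Real.log (Real.log X)))⌋₊ * 2) := by
        rw [← Real.exp_nat_mul]
    _ ≤ Real.exp (2 * Real.log (Real.log X)) := Real.exp_le_exp.2 (by linarith)
    _ = Real.log X ^ 2 := by
        rw [two_mul, Real.exp_add, Real.exp_log hl0]; ring
    _ ≤ (X ^ (ε / 2) / (ε / 2)) ^ 2 := pow_le_pow_left₀ hl0.le hlog 2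
    _ = (2 / ε) ^ 2 * X ^ ε := by
        rw [div_pow, ← Real.rpow_natCast, ← Real.rpow_mul hX0.le]
        have : ε / 2 * (2 : ℕ) = ε := by push_cast; ring
        rw [this]
        field_simp

lemma lt_trickN_mul_trickW (X : ℝ) : X < trickN X * trickW X := by
  have hW : (0 : ℝ) < trickW X := by
    unfold trickW; exact_mod_cast primorial_pos _
  have := Nat.lt_floor_add_one (X / trickW X)
  rw [div_lt_iff₀ hW] at this
  unfold trickN
  exact_mod_cast this

open Classical in
/-- The support of `tau` for a progression modulo `W`. -/
noncomputable def tauSupport (W b : ℕ) (X : ℝ) : Finset ℤ :=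
  (Finset.Icc 1 ((⌊X / W⌋₊ : ℤ) + 1)).filter
    fun n => 1 ≤ (W : ℤ) * n - b ∧ (((W : ℤ) * n - b : ℤ) : ℝ) ≤ X

lemma mem_tauSupport {W b : ℕ} {X : ℝ} (hb : b < W) {n : ℤ} :
    n ∈ tauSupport W b X ↔ 1 ≤ (W : ℤ) * n - b ∧ (((W : ℤ) * n - b : ℤ) : ℝ) ≤ X := by
  unfold tauSupport
  rw [Finset.mem_filter, Finset.mem_Icc]
  refine ⟨fun h => h.2, fun h => ⟨⟨?_, ?_⟩, h⟩⟩
  · by_contra! hn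
    have : (W : ℤ) * n ≤ 0 := mul_nonpos_of_nonneg_of_nonpos (by positivity) (by omega)
    omega
  · have hW : (0 : ℝ) < W := by exact_mod_cast (by omega : 0 < W)
    have h1 : (W : ℝ) * n - b ≤ X := by exact_mod_cast h.2
    have h2 : (b : ℝ) < W := by exact_mod_cast hb
    have h3 : (n : ℝ) - 1 < X / W := by
      rw [lt_div_iff₀ hW]; linarith
    have h4 := h3.trans (Nat.lt_floor_add_one (X / W))
    have h5 : n - 1 < (⌊X / W⌋₊ : ℤ) + 1 := by exact_mod_cast h4
    omega

lemma card_tauSupport_le (W b : ℕ) (X : ℝ) : (tauSupport W b X).card ≤ ⌊X / W⌋₊ + 1 := by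
  unfold tauSupport
  refine (Finset.card_filter_le _ _).trans ?_
  rw [Int.card_Icc]
  omega

lemma fourierSum_eq_trigSum (s : Finset ℤ) (f : ℤ → ℂ) (hf : ∀ n ∉ s, f n = 0) (x : ℝ) :
    fourierSum f x = trigSum s f x := by
  rw [fourierSum, trigSum, tsum_eq_sum (s := s) fun n hn => by rw [hf n hn, zero_mul]]
  refine Finset.sum_congr rfl fun n _ => ?_
  rw [ex]; push_cast; rfl

end PiatetskiShapiro

/-! ### Choice of parameters and conclusion. -/

open PiatetskiShapiro in
theorem lemma3p2 (c : ℝ) (hc1 : 1 < c) (hc2 : c < 2)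
    (u : ℝ) (hu : 2 + 4 * (c - 1) / (2 - c) < u) :
    ∃ C : ℝ, ∀ X : ℝ, Real.exp (Real.exp 1) < X →
      ∀ b : ℕ, b < PiatetskiShapiro.trickW X → Nat.Coprime b (PiatetskiShapiro.trickW X) →
        ∀ f : ℤ → ℂ,
          (∀ n : ℤ, ‖f n‖ ≤ PiatetskiShapiro.tau c (PiatetskiShapiro.trickW X) b X n) →
          ∫ α in (0 : ℝ)..1, ‖PiatetskiShapiro.fourierSum f α‖ ^ u ≤
            C * (PiatetskiShapiro.trickN X : ℝ) ^ (u - 1) := by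
  have hc0 : 0 < c := by linarith
  have hu2 : 2 < u := by
    have : 0 < 4 * (c - 1) / (2 - c) := div_pos (by linarith) (by linarith)
    linarith
  have hu2' : 0 < u - 2 := by linarith
  set γ := 1 / c with hγ
  have hγ0 : 0 < γ := by positivity
  have hγ1 : γ < 1 := by rw [hγ, div_lt_one hc0]; exact hc1
  have hγ2 : 1 / 2 < γ := by
    rw [hγ]; exact one_div_lt_one_div_of_lt hc0 hc2
  -- The saving needed in D/N: raised to the power (u-2)/2, X^e₀ becomes X^(-(1-γ)), which cancels
  -- the sup bound of f in ∑ |f|².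
  set e₀ := -(2 * (1 - γ) / (u - 2)) with he₀
  have he₀0 : e₀ ≤ 0 := by
    rw [he₀, neg_nonpos]; exact div_nonneg (by linarith) hu2'.le
  -- A third of the room left by the hypothesis on u, because D/N carries W³: two factors from the
  -- exponential sums and one from X < NW.
  set ε := ((γ - 1 / 2) + e₀) / 3 with hε
  have hε0 : 0 < ε := by
    have h1 : 2 * (1 - γ) / (u - 2) < γ - 1 / 2 := by
      rw [div_lt_iff₀ hu2']
      have h2 : 4 * (c - 1) < (u - 2) * (2 - c) := by
        rw [← div_lt_iff₀ (by linarith)]; linarith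
      have e1 : 2 * (1 - γ) = 4 * (c - 1) / (2 * c) := by rw [hγ]; field_simp; ring
      have e2 : (γ - 1 / 2) * (u - 2) = (u - 2) * (2 - c) / (2 * c) := by
        rw [hγ]; field_simp
      rw [e1, e2]
      exact div_lt_div_of_pos_right h2 (by positivity)
    have : 0 < (γ - 1 / 2) + e₀ := by rw [he₀]; linarith
    positivity
  set C₁ := 96 * (192 / √(γ * (1 - γ)) * (2 ^ (3 / 2 - γ) / (2 ^ (3 / 2 - γ) - 1))) with hC₁
  have hC₁0 : 0 < C₁ := by
    have h1 : 0 < √(γ * (1 - γ)) := Real.sqrt_pos.2 (mul_pos hγ0 (by linarith))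
    have h2 : (1 : ℝ) < 2 ^ (3 / 2 - γ) := Real.one_lt_rpow (by norm_num) (by linarith)
    have h3 : (0 : ℝ) < 2 ^ (3 / 2 - γ) - 1 := by linarith
    positivity
  set C₄ := C₁ * ((2 / ε) ^ 2) ^ 3 with hC₄
  have hC₄0 : 0 < C₄ := by positivity
  set C₂ := 192 + C₄ with hC₂
  have hC₂0 : 0 < C₂ := by positivity
  set C₃ := (96 : ℝ) ^ (u / 2) * (2 ^ (u / 2) / (u / 2 - 1)) with hC₃
  have hC₃0 : 0 < C₃ := by
    have : 0 < u / 2 - 1 := by linarith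
    positivity
  refine ⟨(2 * C₂) ^ (u / 2) * C₃ + (2 * C₂ * C₄) ^ ((u - 2) / 2) * (2 * C₂), ?_⟩
  intro X hX b hb _ f hf
  have hX1 : 1 < X := (Real.one_lt_exp_iff.2 (Real.exp_pos 1)).trans hX
  have hX0 : 0 < X := by linarith
  have hW1 : 1 ≤ trickW X := primorial_pos _
  have hWε := trickW_le hε0 hX
  have hXN := lt_trickN_mul_trickW X
  have hcardN : ((tauSupport (trickW X) b X).card : ℝ) ≤ trickN X := by
    exact_mod_cast card_tauSupport_le (trickW X) b X
  have hN1 : (1 : ℝ) ≤ trickN X := by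
    unfold trickN; push_cast
    have : (0 : ℝ) ≤ (⌊X / (trickW X : ℝ)⌋₊ : ℝ) := Nat.cast_nonneg _
    linarith
  set W := trickW X with hWdef
  set N : ℝ := (trickN X : ℝ) with hNdef
  have hN0 : 0 < N := by linarith
  have hW0 : (0 : ℝ) < W := by exact_mod_cast hW1
  set s := tauSupport W b X with hs
  have hmem : ∀ n, n ∈ s ↔ 1 ≤ (W : ℤ) * n - b ∧ (((W : ℤ) * n - b : ℤ) : ℝ) ≤ X :=
    fun n => mem_tauSupport hb
  have hf0 : ∀ n ∉ s, f n = 0 := fun n hn => by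
    have h1 := hf n
    rw [hmem] at hn
    rw [tau, if_neg (fun h => hn h.2)] at h1
    exact norm_le_zero_iff.1 h1
  have hXγ : (0 : ℝ) < X ^ (1 - γ) := by positivity
  have hfν : ∀ n ∈ s, ‖f n‖ ≤ fejerMajorant γ W b n := fun n hn => by
    refine (hf n).trans ?_
    rw [tau]
    split_ifs with h
    · exact mul_rpow_le_fejerMajorant hc1 hc2 W b n h.2.1 h.1
    · exact mul_nonneg (by norm_num) (fejer_nonneg _ _)
  have hfX : ∀ n ∈ s, ‖f n‖ ≤ 2 * X ^ (1 - γ) := fun n hn => by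
    refine (hf n).trans ?_
    rw [tau]
    split_ifs with h
    · have h1 : (0 : ℝ) ≤ (((W : ℤ) * n - b : ℤ) : ℝ) := Int.cast_nonneg (by omega)
      exact mul_le_mul hc2.le (Real.rpow_le_rpow h1 h.2.2 (by linarith)) (by positivity)
        (by norm_num)
    · positivity
  have hconn : ∀ a ∈ s, ∀ c ∈ s, ∀ b, a ≤ b → b ≤ c → b ∈ s := by
    intro n1 h1 n3 h3 n2 h12 h23
    rw [hmem] at h1 h3 ⊢
    have i1 : (W : ℤ) * n1 ≤ W * n2 := mul_le_mul_of_nonneg_left h12 (by positivity)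
    have i2 : (W : ℤ) * n2 ≤ W * n3 := mul_le_mul_of_nonneg_left h23 (by positivity)
    refine ⟨by linarith, le_trans ?_ h3.2⟩
    exact_mod_cast (by linarith : (W : ℤ) * n2 - b ≤ W * n3 - b)
  have hDle : C₁ * (W : ℝ) ^ 2 * X ^ (3 / 2 - γ) ≤ C₄ * N * X ^ e₀ := by
    have e1 : X ^ (3 / 2 - γ) = X * X ^ (1 / 2 - γ) := by
      nth_rewrite 2 [← Real.rpow_one X]
      rw [← Real.rpow_add hX0]; congr 1; ring
    have e2 : X ^ e₀ = (X ^ ε) ^ 3 * X ^ (1 / 2 - γ) := by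
      rw [← Real.rpow_natCast, ← Real.rpow_mul hX0.le, ← Real.rpow_add hX0]
      congr 1; rw [hε]; push_cast; ring
    have h1 : 0 < X ^ (1 / 2 - γ) := by positivity
    calc C₁ * (W : ℝ) ^ 2 * X ^ (3 / 2 - γ) = C₁ * (W : ℝ) ^ 2 * X ^ (1 / 2 - γ) * X := by
          rw [e1]; ring
      _ ≤ C₁ * (W : ℝ) ^ 2 * X ^ (1 / 2 - γ) * (N * W) :=
          mul_le_mul_of_nonneg_left hXN.le (by positivity)
      _ = C₁ * X ^ (1 / 2 - γ) * N * (W : ℝ) ^ 3 := by ring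
      _ ≤ C₁ * X ^ (1 / 2 - γ) * N * ((2 / ε) ^ 2 * X ^ ε) ^ 3 :=
          mul_le_mul_of_nonneg_left (pow_le_pow_left₀ hW0.le hWε 3) (by positivity)
      _ = C₄ * N * X ^ e₀ := by rw [e2, hC₄]; ring
  have hXe : X ^ e₀ ≤ 1 := Real.rpow_le_one_of_one_le_of_nonpos hX1.le he₀0
  have hXe0 : 0 < X ^ e₀ := by positivity
  have hν : ∀ x, ‖trigSum s (fun n => (fejerMajorant γ W b n : ℂ)) x‖ ≤
      96 * dirichletMajorant N x + C₄ * N * X ^ e₀ := fun x =>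
    (norm_trigSum_fejerMajorant_le hγ0 hγ1 W b hW1 X hX1.le s hconn
      (fun n hn => (hmem n).1 hn) N hcardN x).trans (by rw [← hC₁]; linarith)
  have hν0 : ∀ n, 0 ≤ fejerMajorant γ W b n := fun n =>
    mul_nonneg (by norm_num) (fejer_nonneg _ _)
  -- The total mass of ν is its transform at 0, where the Dirichlet majorant equals 2N.
  have hνM : ∑ n ∈ s, fejerMajorant γ W b n ≤ C₂ * N := by
    have h1 := hν 0
    have h2 : trigSum s (fun n => (fejerMajorant γ W b n : ℂ)) 0 =
        ((∑ n ∈ s, fejerMajorant γ W b n : ℝ) : ℂ) := by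
      simp [trigSum, ex_zero]
    have h3 : dirichletMajorant N 0 = 2 * N := by simp [dirichletMajorant]
    rw [h2, h3, Complex.norm_real,
      Real.norm_of_nonneg (Finset.sum_nonneg fun n _ => hν0 n)] at h1
    have h4 : C₄ * N * X ^ e₀ ≤ C₄ * N * 1 :=
      mul_le_mul_of_nonneg_left hXe (by positivity)
    rw [hC₂]
    linarith
  -- One factor of |f| is bounded by its supremum and the other by ν.
  have hsq : ∑ n ∈ s, ‖f n‖ ^ 2 ≤ 2 * X ^ (1 - γ) * (C₂ * N) := by
    have h1 : 0 ≤ 2 * X ^ (1 - γ) := by positivity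
    refine le_trans ?_ (mul_le_mul_of_nonneg_left hνM h1)
    rw [Finset.mul_sum]
    refine Finset.sum_le_sum fun n hn => ?_
    rw [pow_two]
    exact mul_le_mul (hfX n hn) (hfν n hn) (norm_nonneg _) (by positivity)
  have hkK : ∫ x in (0 : ℝ)..1, (96 * dirichletMajorant N x) ^ (u / 2) ≤
      C₃ * N ^ (u / 2 - 1) := by
    have e : ∀ x, (96 * dirichletMajorant N x) ^ (u / 2) =
        96 ^ (u / 2) * dirichletMajorant N x ^ (u / 2) := fun x =>
      Real.mul_rpow (by norm_num) (dirichletMajorant_nonneg hN0.le x)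
    simp_rw [e]
    rw [intervalIntegral.integral_const_mul, hC₃, mul_assoc]
    exact mul_le_mul_of_nonneg_left
      (integral_dirichletMajorant_rpow_le hN0 (by linarith)) (by positivity)
  have hmain := integral_norm_trigSum_rpow_le (M := C₂ * N) (D := C₄ * N * X ^ e₀)
    (K := C₃ * N ^ (u / 2 - 1)) hu2 (by positivity) (by positivity) (by positivity) s f
    (fejerMajorant γ W b) (fun x => 96 * dirichletMajorant N x) hfν
    (continuous_const.mul (continuous_dirichletMajorant hN0.le))
    (fun x => mul_nonneg (by norm_num) (dirichletMajorant_nonneg hN0.le x))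
    (fun x => by simp only [periodic_dirichletMajorant N x]) hν hνM hkK
  simp_rw [fourierSum_eq_trigSum s f hf0]
  refine hmain.trans ?_
  rw [add_mul ((2 * C₂) ^ (u / 2) * C₃)]
  refine add_le_add ?_ ?_
  · have e1 : (2 * (C₂ * N)) ^ (u / 2) = (2 * C₂) ^ (u / 2) * N ^ (u / 2) := by
      rw [← mul_assoc, Real.mul_rpow (by positivity) hN0.le]
    have e2 : N ^ (u / 2) * N ^ (u / 2 - 1) = N ^ (u - 1) := by
      rw [← Real.rpow_add hN0]; congr 1; ring
    refine le_of_eq ?_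
    rw [e1, ← e2]; ring
  · refine (mul_le_mul_of_nonneg_left hsq (by positivity)).trans (le_of_eq ?_)
    have e1 : (2 * (C₂ * N) * (C₄ * N * X ^ e₀)) ^ ((u - 2) / 2) =
        (2 * C₂ * C₄) ^ ((u - 2) / 2) * (N ^ (u - 2) * X ^ (-(1 - γ))) := by
      have e : 2 * (C₂ * N) * (C₄ * N * X ^ e₀) = 2 * C₂ * C₄ * (N ^ (2 : ℝ) * X ^ e₀) := by
        rw [Real.rpow_two]; ring
      rw [e, Real.mul_rpow (by positivity) (by positivity),
        Real.mul_rpow (by positivity) hXe0.le, ← Real.rpow_mul hN0.le, ← Real.rpow_mul hX0.le]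
      have e3 : 2 * ((u - 2) / 2) = u - 2 := by ring
      have e4 : e₀ * ((u - 2) / 2) = -(1 - γ) := by rw [he₀]; field_simp
      rw [e3, e4]
    have e2 : N ^ (u - 1) = N ^ (u - 2) * N := by
      nth_rewrite 3 [← Real.rpow_one N]
      rw [← Real.rpow_add hN0]; congr 1; ring
    have e3 : X ^ (-(1 - γ)) * X ^ (1 - γ) = 1 := by
      rw [← Real.rpow_add hX0]; simp
    rw [e1, e2]
    linear_combination ((2 * C₂ * C₄) ^ ((u - 2) / 2) * N ^ (u - 2) * 2 * C₂ * N) * e3
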